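/- **Setting.** Let $R$ be a monoid with group of units $W$ and set of idempotents $E(R)$, the idempotents being ordered by $e\le f \iff ef=fe=e$. A *Renner–Coxeter system* $(R,\Lambda,S)$ consists of such an $R$, a set $\Lambda\subseteq E(R)$ and a set $S\subseteq W$ such that: (i) $R=E(R)W=WE(R)$ and idempotents of $R$ commute (so $E(R)$ is a meet semilattice with meet $ef$, and every $r\in R$ has a unique inverse $r^*$ with $rr^*r=r$, $r^*rr^*=r^*$); (ii) $\Lambda$ contains exactly one element of each $W$-conjugacy class of idempotents and is closed under multiplication; (iii) $(W,S)$ is a Coxeter system; (iv) for idempotents $e\le e'$ there are $w\in W$ and $f\le f'$ in $\Lambda$ with $wew^{-1}=f$, $we'w^{-1}=f'$; (v) for $e\le f$ in $\Lambda$, $\lambda^*(e)\subseteq\lambda^*(f)$, where $\lambda^*(e)=\{s\in S: se=es\ne e\}$; (vi) for $e\in\Lambda$ the subgroups $\{w\in W: we=ew\}$ and $\{w\in W: we=ew=e\}$ are standard parabolic subgroups $W_{\lambda(e)}$ and $W_{\lambda_*(e)}$, where $\lambda(e)=\{s\in S: se=es\}$, $\lambda_*(e)=\{s\in S: se=es=e\}$.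 Let $\le$ also denote the Bruhat order on $W$, and for $I,J\subseteq S$ let ${}^IW^J=\{u\in W: u\le v\ \ \forall v\in W_IuW_J\}$, with ${}^IW={}^IW^{\emptyset}$ and $W^J={}^{\emptyset}W^J$. Each $r\in R$ is uniquely $r=xey$ with $e\in\Lambda$, $x\in W^{\lambda_*(e)}$, $y\in{}^{\lambda(e)}W$ (left standard form) and uniquely $r=yex$ with $e\in\Lambda$, $y\in W^{\lambda(e)}$, $x\in{}^{\lambda_*(e)}W$ (right standard form). The Adherence orders on $R$ are: - for $r=xey$, $s=afb$ in left standard form, $r\le^+s$ iff $e\le f$ and there is $w\in W_{\lambda^*(f)}W_{\lambda_*(e)}$ with $x\le aw$ and $w^{-1}b\le y$; - for $r=yex$, $s=bfa$ in right standard form, $r\le^-s$ iff $e\le f$ and there is $w\in W_{\lambda_*(e)}W_{\lambda^*(f)}$ with $x\le wa$ and $bw^{-1}\le y$. Write $r\,\mathcal L\,s$, $r\,\mathcal R\,s$, $r\,\mathcal J\,s$ for $Rr=Rs$, $rR=sR$, $RrR=RsR$, and $\mathcal H=\mathcal L\cap\mathcal R$. For $T\in\{L,R,J,H\}$ and $\varepsilon\in\{+,-\}$,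 $\min^\varepsilon T_r$ and $\max^\varepsilon T_r$ denote the $\le^\varepsilon$-least and $\le^\varepsilon$-greatest element (if it exists) of the class $T_r$ of $r$ under the corresponding Green's relation. Put $$GJ^\varepsilon=\{r: r=\min{}^\varepsilon L_r\},\quad JG^\varepsilon=\{r: r=\min{}^\varepsilon R_r\},\quad NU^\varepsilon=\{r: r=\min{}^\varepsilon J_r\},\quad O^\varepsilon=\{r: r=\min{}^\varepsilon H_r\}.$$ **Corollary.** Let $(R,\Lambda,S)$ be a Renner–Coxeter system whose group of units $W$ is finite (in particular, any such system with $R$ finite). Then $W$ has a unique longest element $w_0$; put $\Lambda^-=w_0\Lambda w_0$. For each $\varepsilon\in\{+,-\}$: 1. $O^+=O^-$; denote this set by $O$. 2. $NU^\varepsilon=GJ^\varepsilon\cap JG^\varepsilon$. 3. $GJ^\varepsilon$, $JG^\varepsilon$, $NU^\varepsilon$ and $O$ are submonoids of $R$. 4. $GJ^+=(JG^-)^*$ and $JG^+=(GJ^-)^*$. 5. $O$ is the smallest submonoid containing $GJ^\varepsilon$ and $JG^{-\varepsilon}$; it is also the smallest submonoid containing all of $GJ^+,GJ^-,JG^+,JG^-$.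 6. $O$ is the smallest inverse submonoid containing $GJ^\varepsilon$. 7. $O$ is the smallest inverse submonoid containing $JG^\varepsilon$. 8. $w_0\,GJ^\varepsilon=\{r: r=\max^\varepsilon L_r\}$. 9. $JG^\varepsilon w_0=\{r: r=\max^\varepsilon R_r\}$. 10. $w_0\Lambda=\Lambda^-w_0=\{r: r=\max^+J_r\}$ and $w_0\Lambda^-=\Lambda w_0=\{r: r=\max^-J_r\}$. 11. $w_0O=Ow_0=\{r: r=\max^\varepsilon H_r\}$. 12. The quotient maps restrict to bijections $NU^\varepsilon\to R/\mathcal J$, $GJ^\varepsilon\to R/\mathcal L$, $JG^\varepsilon\to R/\mathcal R$, $O\to R/\mathcal H$; that is, each class contains exactly one element of the corresponding set. -/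

import Mathlib

open scoped Pointwise

namespace RennerCoxeter

universe u v

/-! ### Coxeter-theoretic notions -/

section Coxeter

variable {B : Type v} {W : Type u} [Group W] {M : CoxeterMatrix B}

/-- The standard parabolic subgroup `W_I` generated by the simple reflections indexed by `I`. -/
def parabolic (cs : CoxeterSystem M W) (I : Set B) : Subgroup W :=
  Subgroup.closure (cs.simple '' I)

/-- The Bruhat order: some reduced word for `v` has a subword that is a reduced word for `u`. -/
def bruhatLE (cs : CoxeterSystem M W) (u v : W) : Prop :=
  ∃ ω ω' : List B, cs.IsReduced ω ∧ cs.wordProd ω = v ∧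
    ω'.Sublist ω ∧ cs.IsReduced ω' ∧ cs.wordProd ω' = u

/-- The set `ᴵWᴶ` of minimum representatives of the double cosets of `W_I` and `W_J`. -/
def minReps (cs : CoxeterSystem M W) (I J : Set B) : Set W :=
  {u | ∀ a ∈ parabolic cs I, ∀ b ∈ parabolic cs J, bruhatLE cs u (a * u * b)}

/-- `w₀` is the longest element of `W`. -/
def IsLongest (cs : CoxeterSystem M W) (w₀ : W) : Prop :=
  ∀ w : W, w ≠ w₀ → cs.length w < cs.length w₀

end Coxeter

/-! ### Green's relations and inverses in a monoid -/

section Green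

variable (R : Type u) [Monoid R]

/-- The relation `r 𝓛 s` (equality of principal left ideals). -/
def greenL : Setoid R :=
  Setoid.ker fun r : R => Set.range fun a : R => a * r

/-- The relation `r 𝓡 s` (equality of principal right ideals). -/
def greenR : Setoid R :=
  Setoid.ker fun r : R => Set.range fun b : R => r * b

/-- The relation `r 𝓙 s` (equality of principal two-sided ideals). -/
def greenJ : Setoid R :=
  Setoid.ker fun r : R => Set.range fun p : R × R => p.1 * r * p.2

/-- The relation `r 𝓗 s`: both `r 𝓛 s` and `r 𝓡 s`. -/
def greenH : Setoid R := greenL R ⊓ greenR R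

variable {R}

/-- `n` is an inverse of `m` in the sense of inverse semigroups. -/
def IsInverseOf (m n : R) : Prop := m * n * m = m ∧ n * m * n = n

/-- `A* = {a* | a ∈ A}`, the set of inverses of elements of `A`. -/
def starSet (A : Set R) : Set R := {n | ∃ m ∈ A, IsInverseOf m n}

/-- An inverse monoid: every element has exactly one inverse. -/
def IsInverseMonoid (N : Type u) [Monoid N] : Prop := ∀ m : N, ∃! n : N, IsInverseOf m n

/-- The natural order on idempotents. -/
def idemLE (e f : R) : Prop := e * f = e ∧ f * e = e

end Green

/-! ### Renner–Coxeter systems -/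

/-- A factorizable monoid: `R = E(R) Rˣ = Rˣ E(R)`, and `E(R)` is a (meet) semilattice under
multiplication, i.e. idempotents commute. -/
structure IsFactorizable (R : Type u) [Monoid R] : Prop where
  eq_idem_mul_unit : ∀ r : R, ∃ (e : R) (w : Rˣ), IsIdempotentElem e ∧ r = e * w
  eq_unit_mul_idem : ∀ r : R, ∃ (w : Rˣ) (e : R), IsIdempotentElem e ∧ r = w * e
  idem_comm : ∀ e f : R, IsIdempotentElem e → IsIdempotentElem f → e * f = f * e

section System

variable {R : Type u} [Monoid R] {B : Type v} {M : CoxeterMatrix B}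

/-- The type map `λ(e)`. -/
def typeMap (cs : CoxeterSystem M Rˣ) (e : R) : Set B :=
  {i | (cs.simple i : R) * e = e * cs.simple i}

/-- The lower type map `λ_*(e)`. -/
def lowerType (cs : CoxeterSystem M Rˣ) (e : R) : Set B :=
  {i | (cs.simple i : R) * e = e * cs.simple i ∧ (cs.simple i : R) * e = e}

/-- The upper type map `λ^*(e)`. -/
def upperType (cs : CoxeterSystem M Rˣ) (e : R) : Set B :=
  {i | (cs.simple i : R) * e = e * cs.simple i ∧ (cs.simple i : R) * e ≠ e}

/-- `(R, Λ, S)` is a (generalized) Renner–Coxeter system, where `S` is the set of simple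
reflections of the Coxeter system `cs` on the group of units of `R`. -/
structure IsRennerCoxeterSystem (cs : CoxeterSystem M Rˣ) (Λ : Set R) : Prop where
  factorizable : IsFactorizable R
  idem : ∀ e ∈ Λ, IsIdempotentElem e
  transversal : ∀ e : R, IsIdempotentElem e →
    ∃! f : R, f ∈ Λ ∧ ∃ w : Rˣ, (w : R) * e * (w⁻¹ : Rˣ) = f
  mul_mem : ∀ e ∈ Λ, ∀ f ∈ Λ, e * f ∈ Λ
  exists_conj : ∀ e e' : R, IsIdempotentElem e → IsIdempotentElem e' → idemLE e e' →
    ∃ w : Rˣ, ∃ f ∈ Λ, ∃ f' ∈ Λ, idemLE f f' ∧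
      (w : R) * e * (w⁻¹ : Rˣ) = f ∧ (w : R) * e' * (w⁻¹ : Rˣ) = f'
  upperType_mono : ∀ e ∈ Λ, ∀ f ∈ Λ, idemLE e f → upperType cs e ⊆ upperType cs f
  centralizer_parabolic : ∀ e ∈ Λ, ∃ I : Set B,
    ∀ w : Rˣ, w ∈ parabolic cs I ↔ (w : R) * e = e * w
  stabilizer_parabolic : ∀ e ∈ Λ, ∃ I : Set B,
    ∀ w : Rˣ, w ∈ parabolic cs I ↔ ((w : R) * e = e * w ∧ (w : R) * e = e)

/-! ### Standard forms and the Adherence orders -/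

/-- `r = x e y` is in left standard form. -/
def IsLeftStandard (cs : CoxeterSystem M Rˣ) (Λ : Set R) (x : Rˣ) (e : R) (y : Rˣ) (r : R) :
    Prop :=
  r = x * e * y ∧ e ∈ Λ ∧ x ∈ minReps cs ∅ (lowerType cs e) ∧ y ∈ minReps cs (typeMap cs e) ∅

/-- `r = y e x` is in right standard form. -/
def IsRightStandard (cs : CoxeterSystem M Rˣ) (Λ : Set R) (y : Rˣ) (e : R) (x : Rˣ) (r : R) :
    Prop :=
  r = y * e * x ∧ e ∈ Λ ∧ y ∈ minReps cs ∅ (typeMap cs e) ∧ x ∈ minReps cs (lowerType cs e) ∅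

/-- The relation `r ≤⁺ s`. -/
def adhPos (cs : CoxeterSystem M Rˣ) (Λ : Set R) (r s : R) : Prop :=
  ∃ (x : Rˣ) (e : R) (y : Rˣ) (a : Rˣ) (f : R) (b : Rˣ),
    IsLeftStandard cs Λ x e y r ∧ IsLeftStandard cs Λ a f b s ∧ idemLE e f ∧
    ∃ w ∈ (parabolic cs (upperType cs f) : Set Rˣ) * (parabolic cs (lowerType cs e) : Set Rˣ),
      bruhatLE cs x (a * w) ∧ bruhatLE cs (w⁻¹ * b) y

/-- The relation `r ≤⁻ s`. -/
def adhNeg (cs : CoxeterSystem M Rˣ) (Λ : Set R) (r s : R) : Prop :=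
  ∃ (y : Rˣ) (e : R) (x : Rˣ) (b : Rˣ) (f : R) (a : Rˣ),
    IsRightStandard cs Λ y e x r ∧ IsRightStandard cs Λ b f a s ∧ idemLE e f ∧
    ∃ w ∈ (parabolic cs (lowerType cs e) : Set Rˣ) * (parabolic cs (upperType cs f) : Set Rˣ),
      bruhatLE cs x (w * a) ∧ bruhatLE cs (b * w⁻¹) y

/-- The two signs `ε = +` and `ε = -`. -/
inductive Sgn : Type
  | pos : Sgn
  | neg : Sgn

/-- The opposite sign `-ε`. -/
def Sgn.opp : Sgn → Sgn
  | .pos => .neg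
  | .neg => .pos

/-- The Adherence order `r ≤^ε s`. -/
def adh (cs : CoxeterSystem M Rˣ) (Λ : Set R) : Sgn → R → R → Prop
  | .pos => adhPos cs Λ
  | .neg => adhNeg cs Λ

/-! ### Absolute minimum and maximum elements -/

/-- `{r | r = min^ε T_r}`, for an equivalence relation `T`. -/
def minSet (cs : CoxeterSystem M Rˣ) (Λ : Set R) (ε : Sgn) (T : Setoid R) : Set R :=
  {r | ∀ t : R, T r t → adh cs Λ ε r t}

/-- `{r | r = max^ε T_r}`, for an equivalence relation `T`. -/
def maxSet (cs : CoxeterSystem M Rˣ) (Λ : Set R) (ε : Sgn) (T : Setoid R) : Set R :=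
  {r | ∀ t : R, T r t → adh cs Λ ε t r}

/-- `GJ^ε`. -/
def GJ (cs : CoxeterSystem M Rˣ) (Λ : Set R) (ε : Sgn) : Set R := minSet cs Λ ε (greenL R)

/-- `JG^ε`. -/
def JG (cs : CoxeterSystem M Rˣ) (Λ : Set R) (ε : Sgn) : Set R := minSet cs Λ ε (greenR R)

/-- `NU^ε`. -/
def NU (cs : CoxeterSystem M Rˣ) (Λ : Set R) (ε : Sgn) : Set R := minSet cs Λ ε (greenJ R)

/-- `O^ε`. -/
def Oh (cs : CoxeterSystem M Rˣ) (Λ : Set R) (ε : Sgn) : Set R := minSet cs Λ ε (greenH R)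

/-- The translate `w A`. -/
def leftTranslate (w : Rˣ) (A : Set R) : Set R := (fun r => (w : R) * r) '' A

/-- The translate `A w`. -/
def rightTranslate (A : Set R) (w : Rˣ) : Set R := (fun r => r * (w : R)) '' A

/-- The opposite cross-sectional lattice `Λ⁻ = w₀ Λ w₀`. -/
def oppLattice (w₀ : Rˣ) (Λ : Set R) : Set R := (fun e => (w₀ : R) * e * w₀) '' Λ

/-- `O` is the smallest submonoid of `R` containing `A`. -/
def IsSmallestMonoid (A O : Set R) : Prop :=
  IsLeast {X : Set R | (∃ N : Submonoid R, (N : Set R) = X) ∧ A ⊆ X} O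

/-- `O` is the smallest submonoid of `R` that is an inverse monoid and contains `A`. -/
def IsSmallestInverseMonoid (A O : Set R) : Prop :=
  IsLeast {X : Set R | (∃ N : Submonoid R, (N : Set R) = X ∧ IsInverseMonoid N) ∧ A ⊆ X} O

end System

end RennerCoxeter

namespace RennerCoxeter

universe u v

section CoxeterTheory

variable {B : Type v} {W : Type u} [Group W] {M : CoxeterMatrix B} (cs : CoxeterSystem M W)

/-! ### The strong exchange property -/

/-! Every element is `x e y` with a unique `e ∈ Λ`, `y` shortest in `W_λ(e) y` and `x` shortest in
`x W_λ_*(e)`. Inside a Green class `e` is constant, so `r ≤⁺ s` can be certified by the trivial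
witness `w = 1`: the left factor grows and the right factor shrinks in Bruhat order. With `z` the
longest element of `W_λ(e)`, and `x`, `y` now ranging over shortest representatives modulo `W_λ(e)`,
the minima are `e y` for 𝓛, `x e z w₀` for 𝓡, `e z w₀` for 𝓙 and `x e y` for 𝓗. Maxima are found in
the same way. Antisymmetry (`adhPos_antisymm`) upgrades these computations to equalities of sets
(`minSet_eq`, `maxSet_eq`).

Two symmetries do the rest. Inversion `r ↦ r*` exchanges left and right standard forms, hence `≤⁺`
with `≤⁻` and 𝓛 with 𝓡 (`adhNeg_iff`). Conjugation by `w₀` preserves `O`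
(`longest_conj_mem_orderPreserving`) and, combined with inversion, interchanges `GJ⁺` and `JG⁺`
(`mem_jordanGauss_iff`). So everything is reduced to `O` and `GJ⁺`.

The products are the substantial point. For `O` (`orderPreserving_mul`), both factors are restricted
to the largest idempotent on which they compose; since `λ^*` is monotone, restriction keeps
representatives shortest (`exists_restriction`). For `GJ⁺` one needs moreover `e (y f y⁻¹) ∈ Λ`
(`mul_conj_mem`), a fact about double cosets. The generation statements follow from `x e y = (x e)(e
y)`.

The Coxeter input is the strong exchange property, the deletion property, length-additive
factorizations in double cosets (`exists_additive_of_minimal`) and longest elements of parabolic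
subgroups (`bruhatLE_longest_mul`). -/

open Classical in
/-- The action of a simple reflection on `W × ZMod 2`, recording inversions modulo two. -/
noncomputable def signedConj (i : B) : Equiv.Perm (W × ZMod 2) :=
  Function.Involutive.toPerm
    (fun p => (cs.simple i * p.1 * cs.simple i, p.2 + if p.1 = cs.simple i then 1 else 0)) (by
      rintro ⟨t, ε⟩
      have h : cs.simple i * t * cs.simple i = cs.simple i ↔ t = cs.simple i := by
        constructor
        · intro h
          calc t = cs.simple i * (cs.simple i * t * cs.simple i) * cs.simple i := by
                simp [mul_assoc]
            _ = cs.simple i := by rw [h]; simp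
        · rintro rfl; simp
      ext
      · simp [mul_assoc]
      · simp only [h]
        split_ifs
        · rw [add_assoc, CharTwo.add_self_eq_zero, add_zero]
        · simp)

open Classical in
theorem signedConj_apply (i : B) (t : W) (ε : ZMod 2) :
    signedConj cs i (t, ε) =
      (cs.simple i * t * cs.simple i, ε + if t = cs.simple i then 1 else 0) := rfl

-- The sign of `t` flips each time `t` meets one of the reflections `s_j (s_i s_j)^n` with `n < 2k`,
-- taken with repetition.
open Classical in
theorem signedConj_mul_pow (i j : B) (k : ℕ) (t : W) (ε : ZMod 2) :
    ((signedConj cs i * signedConj cs j) ^ k) (t, ε) =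
      ((cs.simple i * cs.simple j) ^ k * t * ((cs.simple i * cs.simple j) ^ k)⁻¹,
        ε + ∑ n ∈ Finset.range (2 * k),
          if t = cs.simple j * (cs.simple i * cs.simple j) ^ n then 1 else 0) := by
  set a := cs.simple i with ha
  set b := cs.simple j with hb
  have haa : a * a = 1 := cs.simple_mul_simple_self i
  have hbb : b * b = 1 := cs.simple_mul_simple_self j
  have hai : a⁻¹ = a := cs.inv_simple i
  have hbi : b⁻¹ = b := cs.inv_simple j
  have hconj : ∀ n : ℕ, b * (a * b) ^ n * b = ((a * b) ^ n)⁻¹ := by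
    intro n
    have : b * (a * b) ^ n * b⁻¹ = (b * (a * b) * b⁻¹) ^ n := by rw [conj_pow]
    rw [hbi] at this
    rw [this, ← inv_pow]
    congr 1
    rw [mul_inv_rev, hai, hbi]
    simp [mul_assoc, hbb]
  have hflip : ∀ n : ℕ, ((a * b) ^ n)⁻¹ * b = b * (a * b) ^ n := by
    intro n
    rw [← hconj, mul_assoc, hbb, mul_one]
  induction k with
  | zero => simp
  | succ k ih =>
    rw [pow_succ', Equiv.Perm.mul_apply, ih, Equiv.Perm.mul_apply, signedConj_apply,
      signedConj_apply, ← ha, ← hb]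
    -- The two letters applied at stage `k + 1` contribute the summands of index `2k` and `2k + 1`.
    have e1 : ((a * b) ^ k * t * ((a * b) ^ k)⁻¹ = b) ↔ t = b * (a * b) ^ (2 * k) := by
      rw [mul_inv_eq_iff_eq_mul, ← eq_inv_mul_iff_mul_eq, ← mul_assoc, hflip, mul_assoc,
        ← pow_add, two_mul]
    have e2 : (b * ((a * b) ^ k * t * ((a * b) ^ k)⁻¹) * b = a) ↔
        t = b * (a * b) ^ (2 * k + 1) := by
      have : b * (a * b) ^ (2 * k + 1) =
          ((a * b) ^ k)⁻¹ * (b * a * b) * (a * b) ^ k := by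
        rw [← mul_assoc, ← mul_assoc, hflip, mul_assoc b, mul_assoc b, mul_assoc b]
        congr 1
        rw [mul_assoc ((a * b) ^ k) a b, mul_assoc, ← pow_succ', ← pow_add]
        congr 1
        ring
      rw [this]
      constructor
      · intro h
        have : (b * a * b) = (a * b) ^ k * t * ((a * b) ^ k)⁻¹ := by
          generalize (a * b) ^ k * t * ((a * b) ^ k)⁻¹ = x at h
          rw [← h]
          simp only [mul_assoc, hbb, mul_one]
          rw [← mul_assoc b b, hbb, one_mul]
        rw [this]
        group
      · rintro rfl
        have : (a * b) ^ k * (((a * b) ^ k)⁻¹ * (b * a * b) * (a * b) ^ k) * ((a * b) ^ k)⁻¹ =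
          b * a * b := by group
        rw [this]
        simp only [mul_assoc, hbb, mul_one]
        rw [← mul_assoc b b, hbb, one_mul]
    ext
    · simp only [pow_succ', mul_inv_rev, hai, hbi]
      simp only [mul_assoc]
    · simp only [e1, e2]
      rw [mul_add, mul_one, Finset.sum_range_succ, Finset.sum_range_succ]
      ring

/-- For `k = M i j` the sum over `2k` indices splits into two equal halves because `(s_i s_j)^k =
1`, and they cancel modulo two. -/
theorem signedConj_isLiftable : M.IsLiftable (signedConj cs) := by
  classical
  intro i j
  ext1 p
  obtain ⟨t, ε⟩ := p
  rw [signedConj_mul_pow, cs.simple_mul_simple_pow, two_mul, Finset.sum_range_add]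
  simp only [pow_add, cs.simple_mul_simple_pow, one_mul]
  rw [CharTwo.add_self_eq_zero]
  simp

/-- The action of `W` on `W × ZMod 2` extending `signedConj`. -/
noncomputable def signedConjHom : W →* Equiv.Perm (W × ZMod 2) :=
  cs.lift ⟨signedConj cs, signedConj_isLiftable cs⟩

-- The left side depends only on the product of the word, hence so does the parity with which `t`
-- occurs in its inversion sequence.
open Classical in
theorem signedConjHom_wordProd (ω : List B) (t : W) (ε : ZMod 2) :
    signedConjHom cs (cs.wordProd ω) (t, ε) =
      (cs.wordProd ω * t * (cs.wordProd ω)⁻¹, ε + ((cs.rightInvSeq ω).count t : ℕ)) := by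
  induction ω generalizing t ε with
  | nil => simp
  | cons i ω ih =>
    rw [cs.wordProd_cons, map_mul, Equiv.Perm.mul_apply, ih]
    have : signedConjHom cs (cs.simple i) = signedConj cs i := cs.lift_apply_simple _ _
    rw [this, signedConj_apply, CoxeterSystem.rightInvSeq, List.count_cons]
    have e : (cs.wordProd ω * t * (cs.wordProd ω)⁻¹ = cs.simple i) ↔
        (cs.wordProd ω)⁻¹ * cs.simple i * cs.wordProd ω = t := by
      rw [mul_inv_eq_iff_eq_mul, mul_assoc, inv_mul_eq_iff_eq_mul, eq_comm]
    ext
    · simp [mul_assoc]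
    · simp only [e, beq_iff_eq]
      split_ifs <;> push_cast <;> ring

/-- The parity of the number of times that `t` occurs as a right inversion of a word for `w`. -/
noncomputable def inversionParity (w t : W) : ZMod 2 := (signedConjHom cs w (t, 0)).2

theorem signedConjHom_apply (w t : W) (ε : ZMod 2) :
    signedConjHom cs w (t, ε) = (w * t * w⁻¹, ε + inversionParity cs w t) := by
  obtain ⟨ω, rfl⟩ := cs.wordProd_surjective w
  rw [inversionParity, signedConjHom_wordProd, signedConjHom_wordProd, zero_add]

theorem inversionParity_mul (w w' t : W) :
    inversionParity cs (w * w') t =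
      inversionParity cs w' t + inversionParity cs w (w' * t * w'⁻¹) := by
  have h := signedConjHom_apply cs (w * w') t 0
  rw [map_mul, Equiv.Perm.mul_apply, signedConjHom_apply, signedConjHom_apply] at h
  simpa using (congrArg Prod.snd h).symm

/-- For `t = w s w⁻¹` the contributions of `w` and `w⁻¹` cancel, by the cocycle rule for `w w⁻¹ =
1`, and `s` contributes one. -/
theorem inversionParity_self {t : W} (ht : cs.IsReflection t) : inversionParity cs t t = 1 := by
  obtain ⟨w, i, rfl⟩ := ht
  have h1 : inversionParity cs 1 (cs.simple i) = 0 := by simp [inversionParity]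
  have h2 : inversionParity cs (cs.simple i) (cs.simple i) = 1 := by
    have := signedConjHom_wordProd cs [i] (cs.simple i) 0
    rw [cs.wordProd_singleton, signedConjHom_apply] at this
    simpa using congrArg Prod.snd this
  have h3 : inversionParity cs w⁻¹ (w * cs.simple i * w⁻¹) +
      inversionParity cs w (cs.simple i) = 0 := by
    have h := inversionParity_mul cs w w⁻¹ (w * cs.simple i * w⁻¹)
    have e : w⁻¹ * (w * cs.simple i * w⁻¹) * w⁻¹⁻¹ = cs.simple i := by group
    rw [e, mul_inv_cancel] at h
    rw [← h]
    simp [inversionParity]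
  rw [mul_assoc w, inversionParity_mul, inversionParity_mul]
  have e : w⁻¹ * (w * (cs.simple i * w⁻¹)) * w⁻¹⁻¹ = cs.simple i := by group
  have e' : cs.simple i * w⁻¹ * (w * (cs.simple i * w⁻¹)) * (cs.simple i * w⁻¹)⁻¹ =
    cs.simple i := by group
  rw [e, e', h2, ← mul_assoc w, add_right_comm, h3, zero_add]

theorem mem_rightInvSeq_of_inversionParity {ω : List B} {t : W}
    (h : inversionParity cs (cs.wordProd ω) t ≠ 0) : t ∈ cs.rightInvSeq ω := by
  classical
  by_contra hn
  apply h
  rw [inversionParity, signedConjHom_wordProd, List.count_eq_zero_of_not_mem hn]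
  simp

/-- Were the parity of `t` in `w` zero, it would be one in `w t`, so `t` would shorten `w t` to `w`,
contrary to the assumption that it shortens `w`. -/
theorem mem_rightInvSeq_of_isRightInversion {ω : List B} {t : W}
    (h : cs.IsRightInversion (cs.wordProd ω) t) : t ∈ cs.rightInvSeq ω := by
  apply mem_rightInvSeq_of_inversionParity
  intro h0
  obtain ⟨ω', hω', hw⟩ := cs.exists_isReduced (cs.wordProd ω * t)
  have h1 : t ∈ cs.rightInvSeq ω' := by
    apply mem_rightInvSeq_of_inversionParity
    rw [← hw, inversionParity_mul, inversionParity_self cs h.1]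
    have : t * t * t⁻¹ = t := by group
    rw [this, h0]
    simp
  have h2 := (cs.isRightInversion_of_mem_rightInvSeq hω' h1).2
  rw [← hw, mul_assoc, h.1.mul_self, mul_one] at h2
  exact absurd h.2 (by omega)

theorem exchange_right {ω : List B} {t : W} (h : cs.IsRightInversion (cs.wordProd ω) t) :
    ∃ j < ω.length, cs.wordProd ω * t = cs.wordProd (ω.eraseIdx j) := by
  obtain ⟨j, hj, rfl⟩ := List.mem_iff_getElem.mp (mem_rightInvSeq_of_isRightInversion cs h)
  refine ⟨j, by simpa using hj, ?_⟩
  rw [← cs.wordProd_mul_getD_rightInvSeq, List.getD_eq_getElem]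

theorem exchange_left {ω : List B} {t : W} (h : cs.IsLeftInversion (cs.wordProd ω) t) :
    ∃ j < ω.length, t * cs.wordProd ω = cs.wordProd (ω.eraseIdx j) := by
  have h' : cs.IsRightInversion (cs.wordProd ω.reverse) t := by
    rw [cs.wordProd_reverse, cs.isRightInversion_inv_iff]; exact h
  have := mem_rightInvSeq_of_isRightInversion cs h'
  rw [cs.rightInvSeq_reverse, List.mem_reverse] at this
  obtain ⟨j, hj, rfl⟩ := List.mem_iff_getElem.mp this
  refine ⟨j, by simpa using hj, ?_⟩
  rw [← cs.getD_leftInvSeq_mul_wordProd, List.getD_eq_getElem]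

/-- The deletion property: every word has a reduced subword with the same product. -/
theorem exists_reduced_sublist (ω : List B) :
    ∃ ω' : List B, ω'.Sublist ω ∧ cs.IsReduced ω' ∧ cs.wordProd ω' = cs.wordProd ω := by
  induction ω with
  | nil => exact ⟨[], List.Sublist.refl _, by simp [CoxeterSystem.IsReduced], rfl⟩
  | cons i ω ih =>
    obtain ⟨ω', hs, hr, hp⟩ := ih
    by_cases hd : cs.IsLeftDescent (cs.wordProd ω') i
    · obtain ⟨j, hj, he⟩ := exchange_left cs
        ((cs.isLeftInversion_simple_iff_isLeftDescent _ _).2 hd)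
      refine ⟨ω'.eraseIdx j, ((List.eraseIdx_sublist _ _).trans hs).trans
        (List.sublist_cons_self _ _), ?_, ?_⟩
      · rw [CoxeterSystem.IsReduced, ← he]
        have h1 := cs.isLeftDescent_iff.1 hd
        have h2 := List.length_eraseIdx_add_one hj
        rw [hr.eq] at h1
        omega
      · rw [← he, hp, cs.wordProd_cons]
    · refine ⟨i :: ω', hs.cons_cons i, ?_, by rw [cs.wordProd_cons, cs.wordProd_cons, hp]⟩
      rw [CoxeterSystem.IsReduced, cs.wordProd_cons, cs.not_isLeftDescent_iff.1 hd, hr.eq]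
      rfl

end CoxeterTheory

section Parabolic

variable {B : Type v} {W : Type u} [Group W] {M : CoxeterMatrix B} (cs : CoxeterSystem M W)

/-! ### Parabolic subgroups -/

theorem simple_mem_parabolic {I : Set B} {i : B} (hi : i ∈ I) : cs.simple i ∈ parabolic cs I :=
  Subgroup.subset_closure ⟨i, hi, rfl⟩

theorem parabolic_mono {I J : Set B} (h : I ⊆ J) : parabolic cs I ≤ parabolic cs J :=
  Subgroup.closure_mono (Set.image_mono h)

theorem parabolic_empty : parabolic cs (∅ : Set B) = ⊥ := by simp [parabolic]

theorem parabolic_le_iff {I : Set B} {H : Subgroup W} :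
    parabolic cs I ≤ H ↔ ∀ i ∈ I, cs.simple i ∈ H := by
  rw [parabolic, Subgroup.closure_le]
  exact Set.image_subset_iff

theorem wordProd_mem_parabolic {I : Set B} {ω : List B} (h : ∀ i ∈ ω, i ∈ I) :
    cs.wordProd ω ∈ parabolic cs I := by
  induction ω with
  | nil => simp
  | cons i ω ih =>
    rw [cs.wordProd_cons]
    exact mul_mem (simple_mem_parabolic cs (h i (by simp)))
      (ih fun j hj => h j (List.mem_cons_of_mem _ hj))

theorem exists_word_of_mem_parabolic {I : Set B} {w : W} (h : w ∈ parabolic cs I) :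
    ∃ ω : List B, (∀ i ∈ ω, i ∈ I) ∧ cs.wordProd ω = w := by
  induction h using Subgroup.closure_induction with
  | mem x hx =>
    obtain ⟨i, hi, rfl⟩ := hx
    exact ⟨[i], by simpa using hi, by simp⟩
  | one => exact ⟨[], by simp, by simp⟩
  | mul x y _ _ hx hy =>
    obtain ⟨ω, h1, rfl⟩ := hx
    obtain ⟨ω', h2, rfl⟩ := hy
    refine ⟨ω ++ ω', fun i hi => ?_, cs.wordProd_append _ _⟩
    rcases List.mem_append.1 hi with h | h
    exacts [h1 i h, h2 i h]
  | inv x _ hx =>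
    obtain ⟨ω, h1, rfl⟩ := hx
    exact ⟨ω.reverse, fun i hi => h1 i (List.mem_reverse.1 hi), cs.wordProd_reverse _⟩

theorem exists_reduced_of_mem_parabolic {I : Set B} {w : W} (h : w ∈ parabolic cs I) :
    ∃ ω : List B, (∀ i ∈ ω, i ∈ I) ∧ cs.IsReduced ω ∧ cs.wordProd ω = w := by
  obtain ⟨ω, h1, rfl⟩ := exists_word_of_mem_parabolic cs h
  obtain ⟨ω', hs, hr, hp⟩ := exists_reduced_sublist cs ω
  exact ⟨ω', fun i hi => h1 i (hs.subset hi), hr, hp⟩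

/-- Exchange in a word with letters from `I` leaves a word with letters from `I`. Membership of the
reflection in `W_I`, rather than of its index in `I`, suffices later. -/
theorem simple_mem_parabolic_of_isLeftDescent {I : Set B} {w : W} (h : w ∈ parabolic cs I) {i : B}
    (hi : cs.IsLeftDescent w i) : cs.simple i ∈ parabolic cs I := by
  obtain ⟨ω, h1, rfl⟩ := exists_word_of_mem_parabolic cs h
  obtain ⟨j, -, he⟩ := exchange_left cs ((cs.isLeftInversion_simple_iff_isLeftDescent _ _).2 hi)
  have h2 : cs.wordProd (ω.eraseIdx j) ∈ parabolic cs I :=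
    wordProd_mem_parabolic cs fun i hi => h1 i ((List.eraseIdx_sublist _ _).subset hi)
  rw [← he] at h2
  simpa using mul_mem h2 (inv_mem h)

/-- The letters of a reduced word for an element of `W_I` lie in `W_I`. -/
theorem simple_mem_parabolic_of_mem_reduced {I : Set B} {ω : List B} (hr : cs.IsReduced ω)
    (h : cs.wordProd ω ∈ parabolic cs I) : ∀ i ∈ ω, cs.simple i ∈ parabolic cs I := by
  induction ω with
  | nil => simp
  | cons i ω ih =>
    have hr' : cs.IsReduced ω := by simpa using hr.drop 1
    have hd : cs.IsLeftDescent (cs.wordProd (i :: ω)) i := by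
      rw [CoxeterSystem.IsLeftDescent, hr.eq, cs.wordProd_cons, cs.simple_mul_simple_cancel_left,
        hr'.eq]
      simp
    have hi := simple_mem_parabolic_of_isLeftDescent cs h hd
    intro j hj
    rcases List.mem_cons.1 hj with rfl | hj
    · exact hi
    · refine ih hr' ?_ j hj
      rw [cs.wordProd_cons] at h
      simpa using mul_mem hi h

/-- Reduced words of `a` and `b` concatenate to a reduced word, all of whose letters lie in `W_I`.
-/
theorem mem_parabolic_of_length_mul {I : Set B} {a b : W} (h : a * b ∈ parabolic cs I)
    (hl : cs.length (a * b) = cs.length a + cs.length b) :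
    a ∈ parabolic cs I ∧ b ∈ parabolic cs I := by
  obtain ⟨ω, hω, rfl⟩ := cs.exists_isReduced a
  obtain ⟨ω', hω', rfl⟩ := cs.exists_isReduced b
  have hr : cs.IsReduced (ω ++ ω') := by
    rw [CoxeterSystem.IsReduced, cs.wordProd_append, hl, hω.eq, hω'.eq, List.length_append]
  rw [← cs.wordProd_append] at h
  have := simple_mem_parabolic_of_mem_reduced cs hr h
  constructor
  · exact Subgroup.list_prod_mem _ fun x hx => by
      obtain ⟨i, hi, rfl⟩ := List.mem_map.1 hx
      exact this i (List.mem_append_left _ hi)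
  · exact Subgroup.list_prod_mem _ fun x hx => by
      obtain ⟨i, hi, rfl⟩ := List.mem_map.1 hx
      exact this i (List.mem_append_right _ hi)

/-! ### Minimal coset representatives -/

/-- `y` is the shortest element of its coset `W_I y`, in additive form. -/
def IsLeftMin (I : Set B) (y : W) : Prop :=
  ∀ p ∈ parabolic cs I, cs.length (p * y) = cs.length p + cs.length y

/-- `x` is the shortest element of its coset `x W_I`, in additive form. -/
def IsRightMin (I : Set B) (x : W) : Prop :=
  ∀ p ∈ parabolic cs I, cs.length (x * p) = cs.length x + cs.length p

variable {cs}

theorem isLeftMin_inv {I : Set B} {x : W} : IsLeftMin cs I x⁻¹ ↔ IsRightMin cs I x := by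
  constructor
  · intro h p hp
    have := h p⁻¹ (inv_mem hp)
    rw [← mul_inv_rev, cs.length_inv, cs.length_inv, cs.length_inv] at this
    omega
  · intro h p hp
    have := h p⁻¹ (inv_mem hp)
    rw [← cs.length_inv, mul_inv_rev, inv_inv, cs.length_inv p] at this
    rw [this, cs.length_inv]
    omega

theorem isRightMin_inv {I : Set B} {x : W} : IsRightMin cs I x⁻¹ ↔ IsLeftMin cs I x := by
  rw [← isLeftMin_inv, inv_inv]

theorem IsRightMin.mono {I J : Set B} (h : I ⊆ J) {y : W} (hy : IsRightMin cs J y) :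
    IsRightMin cs I y := fun p hp => hy p (parabolic_mono cs h hp)

theorem isLeftMin_one (I : Set B) : IsLeftMin cs I 1 := fun p _ => by simp

theorem isRightMin_one (I : Set B) : IsRightMin cs I 1 := fun p _ => by simp

/-- An element of minimal length in its double coset yields length-additive factorizations. -/
theorem exists_additive_of_minimal {I J : Set B} {d : W}
    (hd : ∀ p ∈ parabolic cs I, ∀ q ∈ parabolic cs J, cs.length d ≤ cs.length (p * d * q))
    {p q : W} (hp : p ∈ parabolic cs I) (hq : q ∈ parabolic cs J) :
    ∃ p' ∈ parabolic cs I, ∃ q' ∈ parabolic cs J, p * d * q = p' * d * q' ∧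
      cs.length (p * d * q) = cs.length p' + cs.length d + cs.length q' := by
  obtain ⟨ωp, hIp, rfl⟩ := exists_word_of_mem_parabolic cs hp
  obtain ⟨ωq, hJq, rfl⟩ := exists_word_of_mem_parabolic cs hq
  obtain ⟨ωd, hωd, rfl⟩ := cs.exists_isReduced d
  obtain ⟨ω', hs, hr, he⟩ := exists_reduced_sublist cs (ωp ++ ωd ++ ωq)
  obtain ⟨l1, l2, rfl, h1, h2⟩ := List.sublist_append_iff.1 hs
  obtain ⟨l3, l4, rfl, h3, h4⟩ := List.sublist_append_iff.1 h1
  have hp3 : cs.wordProd l3 ∈ parabolic cs I :=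
    wordProd_mem_parabolic cs fun i hi => hIp i (h3.subset hi)
  have hq2 : cs.wordProd l2 ∈ parabolic cs J :=
    wordProd_mem_parabolic cs fun i hi => hJq i (h2.subset hi)
  simp only [cs.wordProd_append] at he
  -- Deletion cannot touch the middle block: what remains of it represents an element of the double
  -- coset of `d`, and `d` is shortest there.
  have hl4 : l4 = ωd := by
    apply h4.eq_of_length_le
    have e : cs.wordProd l4 = ((cs.wordProd l3)⁻¹ * cs.wordProd ωp) * cs.wordProd ωd *
        (cs.wordProd ωq * (cs.wordProd l2)⁻¹) := by
      calc cs.wordProd l4 = (cs.wordProd l3)⁻¹ *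
            (cs.wordProd l3 * cs.wordProd l4 * cs.wordProd l2) * (cs.wordProd l2)⁻¹ := by group
        _ = _ := by rw [he]; group
    have := hd _ (mul_mem (inv_mem hp3) hp) _ (mul_mem hq (inv_mem hq2))
    rw [← e, hωd.eq] at this
    exact this.trans (cs.length_wordProd_le _)
  subst hl4
  refine ⟨_, hp3, _, hq2, he.symm, ?_⟩
  have r3 : cs.length (cs.wordProd l3) = l3.length := by
    have := hr.take l3.length
    rw [List.append_assoc, List.take_left] at this
    exact this
  have r2 : cs.length (cs.wordProd l2) = l2.length := by
    have := hr.drop (l3 ++ l4).length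
    rw [List.drop_left] at this
    exact this
  rw [← he, ← cs.wordProd_append, ← cs.wordProd_append, hr.eq, r3, r2, hωd.eq]
  simp [add_assoc]

theorem isLeftMin_of_minimal {I : Set B} {y : W}
    (h : ∀ p ∈ parabolic cs I, cs.length y ≤ cs.length (p * y)) : IsLeftMin cs I y := by
  intro p hp
  obtain ⟨p', hp', q', hq', he, hl⟩ := exists_additive_of_minimal (cs := cs) (I := I) (J := ∅)
    (d := y) (by
      intro p hp q hq
      rw [parabolic_empty, Subgroup.mem_bot] at hq
      simpa [hq] using h p hp) hp (one_mem _)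
  rw [parabolic_empty, Subgroup.mem_bot] at hq'
  subst hq'
  simp only [mul_one, mul_left_inj, cs.length_one, add_zero] at he hl
  subst he
  exact hl

theorem isRightMin_of_minimal {I : Set B} {y : W}
    (h : ∀ p ∈ parabolic cs I, cs.length y ≤ cs.length (y * p)) : IsRightMin cs I y := by
  rw [← isLeftMin_inv]
  apply isLeftMin_of_minimal
  intro p hp
  have := h p⁻¹ (inv_mem hp)
  rwa [← cs.length_inv (p * _), mul_inv_rev, inv_inv, cs.length_inv]

theorem exists_minimal_mul {I : Set B} (w : W) :
    ∃ p ∈ parabolic cs I, ∃ y, IsLeftMin cs I y ∧ w = p * y := by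
  classical
  have hne : ∃ n, ∃ p ∈ parabolic cs I, cs.length (p * w) = n := ⟨_, 1, one_mem _, rfl⟩
  obtain ⟨p, hp, hl⟩ := Nat.find_spec hne
  refine ⟨p⁻¹, inv_mem hp, p * w, isLeftMin_of_minimal fun q hq => ?_, by group⟩
  rw [hl]
  exact Nat.find_min' hne ⟨q * p, mul_mem hq hp, by rw [mul_assoc]⟩

theorem exists_mul_minimal {I : Set B} (w : W) :
    ∃ x, IsRightMin cs I x ∧ ∃ p ∈ parabolic cs I, w = x * p := by
  obtain ⟨p, hp, y, hy, h⟩ := exists_minimal_mul (cs := cs) (I := I) w⁻¹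
  refine ⟨y⁻¹, isRightMin_inv.2 hy, p⁻¹, inv_mem hp, ?_⟩
  rw [← mul_inv_rev, ← h, inv_inv]

theorem IsLeftMin.eq_of_mul_eq {I : Set B} {y y' p : W} (hy : IsLeftMin cs I y)
    (hy' : IsLeftMin cs I y') (hp : p ∈ parabolic cs I) (h : y' = p * y) : y' = y := by
  have h1 := hy p hp
  have h2 := hy' p⁻¹ (inv_mem hp)
  rw [← h] at h1
  rw [h, inv_mul_cancel_left, ← h, cs.length_inv] at h2
  have : cs.length p = 0 := by omega
  rw [cs.length_eq_zero_iff] at this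
  simpa [this] using h

/-- If `y = p d` with `d` shortest and `p ≠ 1`, the first letter of a reduced word of `p` is a
descent of `y`. -/
theorem isLeftMin_iff_not_isLeftDescent {I : Set B} {y : W} :
    IsLeftMin cs I y ↔ ∀ i ∈ I, ¬ cs.IsLeftDescent y i := by
  constructor
  · intro h i hi
    rw [cs.not_isLeftDescent_iff, h _ (simple_mem_parabolic cs hi), cs.length_simple, add_comm]
  · intro h
    obtain ⟨p, hp, d, hd, rfl⟩ := exists_minimal_mul (cs := cs) (I := I) y
    obtain ⟨ω, hI, hr, rfl⟩ := exists_reduced_of_mem_parabolic cs hp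
    cases ω with
    | nil => simpa using hd
    | cons i ω =>
      exfalso
      apply h i (hI i (by simp))
      have hω : cs.wordProd ω ∈ parabolic cs I :=
        wordProd_mem_parabolic cs fun j hj => hI j (List.mem_cons_of_mem _ hj)
      rw [CoxeterSystem.IsLeftDescent, hd _ hp, hr.eq, cs.wordProd_cons, mul_assoc,
        cs.simple_mul_simple_cancel_left, hd _ hω]
      have := cs.length_wordProd_le ω
      simp only [List.length_cons]
      omega

theorem isRightMin_iff_not_isRightDescent {I : Set B} {y : W} :
    IsRightMin cs I y ↔ ∀ i ∈ I, ¬ cs.IsRightDescent y i := by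
  rw [← isLeftMin_inv, isLeftMin_iff_not_isLeftDescent]
  simp only [cs.isLeftDescent_inv_iff]

/-- A length-additive left factor of the shortest element of `W_I y` has the same property. -/
theorem IsLeftMin.of_mul {I : Set B} {a b : W} (h : IsLeftMin cs I (a * b))
    (hl : cs.length (a * b) = cs.length a + cs.length b) : IsLeftMin cs I a := by
  apply isLeftMin_of_minimal
  intro p hp
  have h1 := h p hp
  have h2 := cs.length_mul_le (p * a) b
  rw [mul_assoc] at h2
  omega

theorem IsRightMin.of_mul {I : Set B} {a b : W} (h : IsRightMin cs I (a * b))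
    (hl : cs.length (a * b) = cs.length a + cs.length b) : IsRightMin cs I b := by
  apply isRightMin_of_minimal
  intro p hp
  have h1 := h p hp
  have h2 := cs.length_mul_le a (b * p)
  rw [← mul_assoc] at h2
  omega

/-- An element that is shortest in both of its cosets is shortest in its double coset. -/
theorem IsLeftMin.length_le_double {I J : Set B} {y : W} (hI : IsLeftMin cs I y)
    (hJ : IsRightMin cs J y) :
    ∀ p ∈ parabolic cs I, ∀ q ∈ parabolic cs J, cs.length y ≤ cs.length (p * y * q) := by
  classical
  have hne : ∃ n, ∃ p ∈ parabolic cs I, ∃ q ∈ parabolic cs J, cs.length (p * y * q) = n :=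
    ⟨_, 1, one_mem _, 1, one_mem _, rfl⟩
  obtain ⟨p, hp, q, hq, hl⟩ := Nat.find_spec hne
  have hmin : ∀ p' ∈ parabolic cs I, ∀ q' ∈ parabolic cs J,
      cs.length (p * y * q) ≤ cs.length (p' * (p * y * q) * q') := by
    intro p' hp' q' hq'
    rw [hl]
    exact Nat.find_min' hne ⟨p' * p, mul_mem hp' hp, q * q', mul_mem hq hq', by
      simp only [mul_assoc]⟩
  -- Write `y = a m b` additively with `m` shortest in the double coset. Minimality of `y` on the
  -- left gives `ℓ(m b) = ℓ(a) + ℓ(y)`, which forces `ℓ(a) = 0`; likewise `ℓ(b) = 0` on the right.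
  obtain ⟨a, ha, b, hb, he, hla⟩ :=
    exists_additive_of_minimal hmin (inv_mem hp) (inv_mem hq)
  have e1 : p⁻¹ * (p * y * q) * q⁻¹ = y := by group
  rw [e1] at he hla
  have h1 := hI a⁻¹ (inv_mem ha)
  have h2 := hJ b⁻¹ (inv_mem hb)
  have e2 : a⁻¹ * y = p * y * q * b := by
    rw [inv_mul_eq_iff_eq_mul, ← mul_assoc, ← he]
  have e3 : y * b⁻¹ = a * (p * y * q) := by
    rw [mul_inv_eq_iff_eq_mul, ← he]
  rw [e2, cs.length_inv] at h1
  rw [e3, cs.length_inv] at h2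
  have h3 := cs.length_mul_le (p * y * q) b
  have h4 := cs.length_mul_le a (p * y * q)
  intro p' hp' q' hq'
  refine le_trans (by omega) (hl.le.trans (Nat.find_min' hne ⟨p', hp', q', hq', rfl⟩))

/-- After rewriting `p d q` length-additively, each factor inherits membership in `W_K`. -/
theorem exists_factor_in_parabolic {I J K : Set B} {d p q : W} (hI : IsLeftMin cs I d)
    (hJ : IsRightMin cs J d) (hp : p ∈ parabolic cs I) (hq : q ∈ parabolic cs J)
    (hK : p * d * q ∈ parabolic cs K) :
    ∃ p' q', p' ∈ parabolic cs I ∧ p' ∈ parabolic cs K ∧ q' ∈ parabolic cs J ∧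
      q' ∈ parabolic cs K ∧ p * d * q = p' * d * q' := by
  obtain ⟨p', hp', q', hq', he, hl⟩ := exists_additive_of_minimal (hI.length_le_double hJ) hp hq
  have h1 := hI p' hp'
  rw [he] at hK hl
  obtain ⟨h2, h3⟩ := mem_parabolic_of_length_mul cs hK (by rw [hl, h1])
  exact ⟨p', q', hp', (mem_parabolic_of_length_mul cs h2 h1).1, hq', h3, he⟩

theorem IsRightMin.eq_one_of_mem {I : Set B} {x : W} (h : IsRightMin cs I x)
    (hx : x ∈ parabolic cs I) : x = 1 := by
  have := h x⁻¹ (inv_mem hx)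
  rw [mul_inv_cancel, cs.length_one] at this
  rw [← cs.length_eq_zero_iff]
  omega

theorem IsRightMin.eq_of_inv_mul_mem {I : Set B} {x x' : W} (hx : IsRightMin cs I x)
    (hx' : IsRightMin cs I x') (h : x⁻¹ * x' ∈ parabolic cs I) : x = x' := by
  have := IsLeftMin.eq_of_mul_eq (isLeftMin_inv.2 hx') (isLeftMin_inv.2 hx) h
    (by group)
  exact inv_injective this

/-- If `v ∈ W_I` has no right descent in `J ⊆ I` and `x` is the shortest element of `x W_I`, then
`x v` has no right descent in `J`. -/
theorem IsRightMin.mul {I J : Set B} (hJ : J ⊆ I) {x v : W} (hx : IsRightMin cs I x)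
    (hv : v ∈ parabolic cs I) (h : IsRightMin cs J v) : IsRightMin cs J (x * v) := by
  intro p hp
  rw [mul_assoc, hx _ (mul_mem hv (parabolic_mono cs hJ hp)), hx _ hv, h _ hp, add_assoc]

/-- In a reduced word, the last letter from `J` could be moved past the letters from `I` to the end,
where it would be a right descent. -/
theorem mem_parabolic_of_isRightMin {I J : Set B}
    (hcomm : ∀ i ∈ I, ∀ j ∈ J, cs.simple i * cs.simple j = cs.simple j * cs.simple i)
    {a : W} (ha : a ∈ parabolic cs (I ∪ J)) (hJ : IsRightMin cs J a) : a ∈ parabolic cs I := by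
  obtain ⟨ω, hω, hr, rfl⟩ := exists_reduced_of_mem_parabolic cs ha
  rw [isRightMin_iff_not_isRightDescent] at hJ
  suffices key : ∀ ω : List B, (∀ i ∈ ω, i ∈ I ∪ J) → cs.IsReduced ω →
      (∀ i ∈ ω, i ∈ I) ∨ ∃ j ∈ J, cs.IsRightDescent (cs.wordProd ω) j by
    rcases key ω hω hr with h | ⟨j, hj, hd⟩
    · exact wordProd_mem_parabolic cs h
    · exact absurd hd (hJ j hj)
  intro ω
  induction ω using List.reverseRecOn with
  | nil => simp
  | append_singleton ω i ih =>
    intro hω hr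
    have hr' : cs.IsReduced ω := by simpa using hr.take ω.length
    have hl : cs.length (cs.wordProd ω * cs.simple i) = cs.length (cs.wordProd ω) + 1 := by
      have := hr.eq
      rw [cs.wordProd_append, cs.wordProd_singleton] at this
      rw [this, hr'.eq, List.length_append, List.length_singleton]
    rcases hω i (by simp) with hi | hi
    · rcases ih (fun j hj => hω j (List.mem_append_left _ hj)) hr' with h | ⟨j, hj, hd⟩
      · left
        intro j hj
        rcases List.mem_append.1 hj with hj | hj
        · exact h j hj
        · rw [List.mem_singleton.1 hj]; exact hi
      · right
        refine ⟨j, hj, ?_⟩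
        rw [CoxeterSystem.IsRightDescent, cs.wordProd_append, cs.wordProd_singleton, hl, mul_assoc,
          hcomm i hi j hj, ← mul_assoc]
        have h1 := cs.length_mul_le (cs.wordProd ω * cs.simple j) (cs.simple i)
        rw [cs.length_simple] at h1
        have h2 := cs.isRightDescent_iff.1 hd
        omega
    · right
      refine ⟨i, hi, ?_⟩
      rw [CoxeterSystem.IsRightDescent, cs.wordProd_append, cs.wordProd_singleton, hl, mul_assoc,
        cs.simple_mul_simple_self, mul_one]
      omega

/-- If `s_j s_i s_j` were reduced, its letters would lie in `W_I`, which `s_j` does not. So exchange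
applies, and the only consistent erasure gives `s_j s_i s_j = s_i`. -/
theorem simple_commute_of_conj_mem {I : Set B} {i j : B} (hi : cs.simple i ∈ parabolic cs I)
    (hj : cs.simple j ∉ parabolic cs I)
    (h : cs.simple j * cs.simple i * cs.simple j ∈ parabolic cs I) :
    cs.simple i * cs.simple j = cs.simple j * cs.simple i := by
  have hne : cs.simple j ≠ cs.simple i := fun e => hj (e ▸ hi)
  have h2 : cs.length (cs.simple j * cs.simple i) = 2 := by
    rcases cs.length_mul_simple (cs.simple j) i with h | h
    · rw [h, cs.length_simple]
    · rw [cs.length_simple, Nat.add_eq_right, cs.length_eq_zero_iff] at h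
      exact absurd (mul_eq_one_iff_eq_inv.1 h) (by simpa using hne)
  by_cases hd : cs.IsRightDescent (cs.simple j * cs.simple i) j
  · have e2 : cs.simple j * cs.simple i = cs.wordProd [j, i] := by simp [cs.wordProd_cons]
    rw [e2] at hd
    obtain ⟨n, hn, he⟩ := exchange_right cs
      ((cs.isRightInversion_simple_iff_isRightDescent _ _).2 hd)
    rw [← e2] at he
    have hn' : n = 0 ∨ n = 1 := by simp at hn; omega
    rcases hn' with rfl | rfl
    · simp only [List.eraseIdx_zero, List.tail_cons, cs.wordProd_singleton] at he
      nth_rewrite 1 [← he]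
      simp
    · simp only [List.eraseIdx_cons_succ, List.eraseIdx_zero, List.tail_cons,
        cs.wordProd_singleton] at he
      rw [mul_assoc, mul_eq_left, mul_eq_one_iff_eq_inv] at he
      exact absurd he.symm (by simpa using hne)
  · exfalso
    rw [cs.not_isRightDescent_iff, h2] at hd
    have hr : cs.IsReduced [j, i, j] := by
      rw [CoxeterSystem.IsReduced, cs.wordProd_cons, cs.wordProd_cons, cs.wordProd_singleton,
        ← mul_assoc, hd]
      rfl
    refine hj (simple_mem_parabolic_of_mem_reduced cs (I := I) hr ?_ j (by simp))
    simpa [cs.wordProd_cons, mul_assoc] using h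

/-! ### The Bruhat order -/

theorem bruhatLE_length_le {u v : W} (h : bruhatLE cs u v) : cs.length u ≤ cs.length v := by
  obtain ⟨ω, ω', hr, rfl, hs, hr', rfl⟩ := h
  rw [hr.eq, hr'.eq]
  exact hs.length_le

theorem bruhatLE_eq_of_length_le {u v : W} (h : bruhatLE cs u v)
    (hl : cs.length v ≤ cs.length u) : u = v := by
  obtain ⟨ω, ω', hr, rfl, hs, hr', rfl⟩ := h
  rw [hr.eq, hr'.eq] at hl
  rw [hs.eq_of_length_le hl]

theorem bruhatLE_inv {u v : W} (h : bruhatLE cs u v) : bruhatLE cs u⁻¹ v⁻¹ := by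
  obtain ⟨ω, ω', hr, rfl, hs, hr', rfl⟩ := h
  exact ⟨ω.reverse, ω'.reverse, hr.reverse, cs.wordProd_reverse _, hs.reverse, hr'.reverse,
    cs.wordProd_reverse _⟩

theorem bruhatLE_inv_iff {u v : W} : bruhatLE cs u⁻¹ v⁻¹ ↔ bruhatLE cs u v :=
  ⟨fun h => by simpa using bruhatLE_inv h, bruhatLE_inv⟩

/-- Up to inversion, every Bruhat comparison established below is such a deletion of a middle
factor; transitivity of the order is never needed. -/
theorem bruhatLE_of_length_add {a p b : W}
    (h : cs.length (a * p * b) = cs.length a + cs.length p + cs.length b)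
    (h' : cs.length (a * b) = cs.length a + cs.length b) : bruhatLE cs (a * b) (a * p * b) := by
  obtain ⟨ωa, ha, rfl⟩ := cs.exists_isReduced a
  obtain ⟨ωp, hp, rfl⟩ := cs.exists_isReduced p
  obtain ⟨ωb, hb, rfl⟩ := cs.exists_isReduced b
  rw [ha.eq, hb.eq] at h h'
  rw [hp.eq] at h
  refine ⟨ωa ++ ωp ++ ωb, ωa ++ ωb, ?_, by simp [cs.wordProd_append, mul_assoc], ?_, ?_,
    by simp [cs.wordProd_append]⟩
  · rw [CoxeterSystem.IsReduced, cs.wordProd_append, cs.wordProd_append, h]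
    simp [add_assoc]
  · exact (List.sublist_append_left _ _).append (List.Sublist.refl _)
  · rw [CoxeterSystem.IsReduced, cs.wordProd_append, h']
    simp

theorem bruhatLE_mul_right {a b : W} (h : cs.length (a * b) = cs.length a + cs.length b) :
    bruhatLE cs a (a * b) := by
  simpa using bruhatLE_of_length_add (cs := cs) (a := a) (p := b) (b := 1) (by simpa using h)
    (by simp)

theorem bruhatLE_mul_left {a b : W} (h : cs.length (a * b) = cs.length a + cs.length b) :
    bruhatLE cs b (a * b) := by
  simpa using bruhatLE_of_length_add (cs := cs) (a := 1) (p := a) (b := b) (by simpa using h)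
    (by simp)

theorem bruhatLE_refl (a : W) : bruhatLE cs a a := by
  simpa using bruhatLE_mul_right (cs := cs) (a := a) (b := 1) (by simp)

theorem one_bruhatLE (a : W) : bruhatLE cs 1 a := by
  simpa using bruhatLE_mul_right (cs := cs) (a := 1) (b := a) (by simp)

/-- Bruhat-least implies shortest; conversely length additivity makes `y` a suffix of each `p y`. -/
theorem mem_minReps_empty_right {I : Set B} {y : W} : y ∈ minReps cs I ∅ ↔ IsLeftMin cs I y := by
  constructor
  · intro h
    apply isLeftMin_of_minimal
    intro p hp
    simpa using bruhatLE_length_le (h p hp 1 (one_mem _))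
  · intro h p hp q hq
    rw [parabolic_empty, Subgroup.mem_bot] at hq
    subst hq
    rw [mul_one]
    exact bruhatLE_mul_left (h p hp)

theorem mem_minReps_empty_left {I : Set B} {y : W} : y ∈ minReps cs ∅ I ↔ IsRightMin cs I y := by
  constructor
  · intro h
    apply isRightMin_of_minimal
    intro p hp
    simpa using bruhatLE_length_le (h 1 (one_mem _) p hp)
  · intro h p hp q hq
    rw [parabolic_empty, Subgroup.mem_bot] at hp
    subst hp
    rw [one_mul]
    exact bruhatLE_mul_right (h q hq)

/-! ### Longest elements -/

variable (cs) in
/-- `z` is the longest element of `W_I`. -/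
def IsLongestIn (I : Set B) (z : W) : Prop :=
  z ∈ parabolic cs I ∧ ∀ u ∈ parabolic cs I, cs.length u + cs.length (u⁻¹ * z) = cs.length z

-- An element `z` of maximal length works: induction on reduced words shows that each of them is a
-- prefix of a reduced word of `z`.
variable (cs) in
theorem exists_isLongestIn [Finite W] (I : Set B) : ∃ z, IsLongestIn cs I z := by
  have : Nonempty (parabolic cs I) := ⟨1⟩
  obtain ⟨⟨z, hz⟩, hmax⟩ := Finite.exists_max fun w : parabolic cs I => cs.length (w : W)
  refine ⟨z, hz, ?_⟩
  suffices key : ∀ ω : List B, (∀ i ∈ ω, i ∈ I) → cs.IsReduced ω →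
      ω.length + cs.length ((cs.wordProd ω)⁻¹ * z) = cs.length z by
    intro u hu
    obtain ⟨ω, hI, hr, rfl⟩ := exists_reduced_of_mem_parabolic cs hu
    rw [hr.eq, key ω hI hr]
  intro ω
  induction ω using List.reverseRecOn with
  | nil => simp
  | append_singleton ω i ih =>
    intro hI hr
    have hr' : cs.IsReduced ω := by simpa using hr.take ω.length
    have hI' : ∀ i ∈ ω, i ∈ I := fun j hj => hI j (List.mem_append_left _ hj)
    have hωI := wordProd_mem_parabolic cs hI'
    have h1 := ih hI' hr'
    set w := (cs.wordProd ω)⁻¹ * z with hw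
    have hz' : z = cs.wordProd ω * w := by rw [hw, mul_inv_cancel_left]
    have e : (cs.wordProd (ω ++ [i]))⁻¹ * z = cs.simple i * w := by
      rw [cs.wordProd_append, cs.wordProd_singleton, mul_inv_rev, cs.inv_simple, mul_assoc]
    rw [e, List.length_append, List.length_singleton]
    rcases cs.length_simple_mul w i with h | h
    swap
    · omega
    exfalso
    obtain ⟨ω', hr2, hw'⟩ := cs.exists_isReduced w
    -- Left multiplication by `t` inserts `s_i` after the prefix `ω`. By maximality `t z` is shorter
    -- than `z`, so exchange erases a letter of `ω`, contradicting that `ω s_i` is reduced, or of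
    -- the remainder, contradicting that `s_i` lengthens it.
    set t := cs.wordProd ω * cs.simple i * (cs.wordProd ω)⁻¹ with ht
    have htr : cs.IsReflection t := ⟨_, i, rfl⟩
    have htI : t ∈ parabolic cs I :=
      mul_mem (mul_mem hωI (simple_mem_parabolic cs (hI i (by simp)))) (inv_mem hωI)
    have hlt : cs.length (t * z) < cs.length z :=
      lt_of_le_of_ne (hmax ⟨t * z, mul_mem htI hz⟩) (htr.length_mul_right_ne z)
    have hzw : z = cs.wordProd (ω ++ ω') := by rw [cs.wordProd_append, ← hw', ← hz']
    have htz : t * z = cs.wordProd ω * (cs.simple i * w) := by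
      rw [hz', ht]; group
    rw [hzw] at hlt
    obtain ⟨j, hj, he⟩ := exchange_left cs ⟨htr, hlt⟩
    rw [← hzw, htz] at he
    rw [List.length_append] at hj
    by_cases hjl : j < ω.length
    · rw [List.eraseIdx_append_of_lt_length hjl, cs.wordProd_append, ← hw', ← mul_assoc,
        mul_left_inj] at he
      have h3 := hr.eq
      rw [cs.wordProd_append, cs.wordProd_singleton, he, List.length_append] at h3
      have h4 := cs.length_wordProd_le (ω.eraseIdx j)
      have h5 := List.length_eraseIdx_add_one hjl
      simp only [List.length_singleton] at h3
      omega
    · rw [List.eraseIdx_append_of_length_le (by omega), cs.wordProd_append, mul_right_inj] at he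
      have h4 := cs.length_wordProd_le (ω'.eraseIdx (j - ω.length))
      have h5 := List.length_eraseIdx_add_one (l := ω') (i := j - ω.length) (by omega)
      rw [← he, h, hw', hr2.eq] at h4
      omega

namespace IsLongestIn

variable {I : Set B} {z : W}

theorem mul_self (h : IsLongestIn cs I z) : z * z = 1 := by
  have := h.2 z⁻¹ (inv_mem h.1)
  rw [inv_inv, cs.length_inv] at this
  rw [← cs.length_eq_zero_iff]
  omega

theorem inv_eq (h : IsLongestIn cs I z) : z⁻¹ = z :=
  inv_eq_of_mul_eq_one_left h.mul_self

theorem mul_right (h : IsLongestIn cs I z) {u : W} (hu : u ∈ parabolic cs I) :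
    cs.length u + cs.length (z * u) = cs.length z := by
  have := h.2 u hu
  rwa [← cs.length_inv (u⁻¹ * z), mul_inv_rev, inv_inv, h.inv_eq] at this

end IsLongestIn

/-- Left multiplication by `z` reverses lengths in `W_I`, and left multiplication by `k` reverses
them in `W_K`. -/
theorem IsLongestIn.isRightMin_mul {I K : Set B} (hK : K ⊆ I) {z k : W} (hz : IsLongestIn cs I z)
    (hk : IsLongestIn cs K k) : IsRightMin cs K (z * k) := by
  apply isRightMin_of_minimal
  intro p hp
  have hkp := parabolic_mono cs hK (mul_mem hk.1 hp)
  have h1 := hz.mul_right (parabolic_mono cs hK hk.1)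
  have h2 := hz.mul_right hkp
  have h3 := hk.mul_right hp
  rw [mul_assoc]
  omega

/-- In `x W_I`, the elements without right descents in `K ⊆ I` lie below `x w_I w_K`. -/
theorem bruhatLE_longest_mul {I K : Set B} (hK : K ⊆ I) {z k x u : W} (hz : IsLongestIn cs I z)
    (hk : IsLongestIn cs K k) (hx : IsRightMin cs I x) (hu : u ∈ parabolic cs I)
    (hxu : IsRightMin cs K (x * u)) : bruhatLE cs (x * u) (x * (z * k)) := by
  have hkI := parabolic_mono cs hK hk.1
  have hxul := hx u hu
  have hur : IsRightMin cs K u := hxu.of_mul hxul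
  have huk := mul_mem hu hkI
  have h1 := hz.mul_right (inv_mem huk)
  rw [cs.length_inv, hur k hk.1, mul_inv_rev, hk.inv_eq, ← mul_assoc] at h1
  have h2 := hz.mul_right hkI
  have hpI : z * k * u⁻¹ ∈ parabolic cs I := mul_mem (mul_mem hz.1 hkI) (inv_mem hu)
  have e : z * k = (z * k * u⁻¹) * u := by group
  have h3 := hx _ (mul_mem hz.1 hkI)
  -- The length of `z k u⁻¹` is `ℓ(z) - ℓ(k) - ℓ(u)`, so this factorization is length-additive and
  -- `x u` arises by deleting its middle factor.
  have e2 : x * (z * k) = x * (z * k * u⁻¹) * u := by group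
  rw [e2]
  apply bruhatLE_of_length_add _ hxul
  rw [← e2, h3]
  omega

/-- Here `w` is longest in the whole group, so `ℓ(w x z p) = ℓ(w) - ℓ(x) - ℓ(z p)`, and `ℓ(z p) =
ℓ(z) - ℓ(p)` is greatest at `p = 1`. -/
theorem IsLongestIn.isRightMin_conj {I J : Set B} {w z x : W} (hw : IsLongestIn cs J w)
    (hJ : parabolic cs J = ⊤) (hz : IsLongestIn cs I z) (hx : IsRightMin cs I x) :
    IsRightMin cs I (w * x * z) := by
  have hmem : ∀ u : W, u ∈ parabolic cs J := fun u => hJ ▸ Subgroup.mem_top u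
  apply isRightMin_of_minimal
  intro p hp
  have h1 := hw.mul_right (hmem (x * z))
  have h2 := hw.mul_right (hmem (x * (z * p)))
  have h3 := hx _ hz.1
  have h4 := hx _ (mul_mem hz.1 hp)
  have h5 := hz.mul_right hp
  rw [mul_assoc w, mul_assoc w, mul_assoc x]
  omega

theorem parabolic_univ : parabolic cs (Set.univ : Set B) = ⊤ := by
  rw [parabolic, Set.image_univ, cs.subgroup_closure_range_simple]

theorem IsLongestIn.isLongest {z : W} (h : IsLongestIn cs Set.univ z) : IsLongest cs z := by
  intro w hw
  have h1 := h.2 w (parabolic_univ (cs := cs) ▸ Subgroup.mem_top w)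
  rcases Nat.eq_zero_or_pos (cs.length (w⁻¹ * z)) with h0 | h0
  · rw [cs.length_eq_zero_iff, inv_mul_eq_one] at h0
    exact absurd h0 hw
  · omega

end Parabolic

/-! ### Factorizable inverse monoids -/

section Factorizable

variable {R : Type u} [Monoid R]

theorem isIdempotentElem_conj {e : R} (he : IsIdempotentElem e) (w : Rˣ) :
    IsIdempotentElem ((w : R) * e * (w⁻¹ : Rˣ)) := by
  have h : e * e = e := he
  calc (w : R) * e * (w⁻¹ : Rˣ) * (w * e * (w⁻¹ : Rˣ)) = w * (e * e) * (w⁻¹ : Rˣ) := by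
        simp [mul_assoc]
    _ = _ := by rw [h]

theorem conj_eq_iff_commute {e : R} {w : Rˣ} :
    (w : R) * e * (w⁻¹ : Rˣ) = e ↔ (w : R) * e = e * w :=
  Units.mul_inv_eq_iff_eq_mul w

theorem conj_eq_conj_iff {e : R} {a b : Rˣ} :
    (a : R) * e * (a⁻¹ : Rˣ) = b * e * (b⁻¹ : Rˣ) ↔
      ((a⁻¹ * b : Rˣ) : R) * e = e * (a⁻¹ * b : Rˣ) := by
  constructor
  · intro h
    calc ((a⁻¹ * b : Rˣ) : R) * e = (a⁻¹ : Rˣ) * (b * e * (b⁻¹ : Rˣ)) * b := by simp [mul_assoc]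
      _ = e * (a⁻¹ * b : Rˣ) := by rw [← h]; simp [mul_assoc]
  · intro h
    calc (a : R) * e * (a⁻¹ : Rˣ) = a * (e * (a⁻¹ * b : Rˣ)) * (b⁻¹ : Rˣ) := by simp [mul_assoc]
      _ = b * e * (b⁻¹ : Rˣ) := by rw [← h]; simp [mul_assoc]

namespace IsFactorizable

variable (hF : IsFactorizable R)
include hF

/-- Each idempotent absorbs the other on the right, and idempotents commute. -/
theorem eq_of_eq_unit_mul {p q : R} (hp : IsIdempotentElem p) (hq : IsIdempotentElem q) {w : Rˣ}
    (h : p = w * q) : p = q := by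
  have hp' : p * p = p := hp
  have hq' : q * q = q := hq
  have h1 : p * q = p := by rw [h, mul_assoc, hq']
  have h2 : q = (w⁻¹ : Rˣ) * p := by rw [h]; simp
  have h3 : q * p = q := by
    calc q * p = (w⁻¹ : Rˣ) * (p * p) := by rw [← mul_assoc, ← h2]
      _ = q := by rw [hp', ← h2]
  rw [← h1, hF.idem_comm p q hp hq, h3]

theorem eq_of_eq_mul_unit {p q : R} (hp : IsIdempotentElem p) (hq : IsIdempotentElem q) {w : Rˣ}
    (h : p = q * w) : p = q := by
  have hp' : p * p = p := hp
  have hq' : q * q = q := hq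
  have h1 : q * p = p := by rw [h, ← mul_assoc, hq']
  have h2 : q = p * (w⁻¹ : Rˣ) := by rw [h]; simp
  have h3 : p * q = q := by rw [h2, ← mul_assoc, hp']
  rw [← h1, ← hF.idem_comm p q hp hq, h3]

/-- Since `e w = w⁻¹ e w` is an idempotent differing from `e` by a unit factor, it equals `e`. -/
theorem mul_unit_eq_self {e : R} (he : IsIdempotentElem e) {w : Rˣ} (h : (w : R) * e = e) :
    e * w = e := by
  have h1 : ((w⁻¹ : Rˣ) : R) * e = e := by rw [Units.inv_mul_eq_iff_eq_mul, h]
  have h2 : e * w = (w⁻¹ : Rˣ) * e * (w⁻¹⁻¹ : Rˣ) := by rw [h1, inv_inv]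
  have h3 : IsIdempotentElem (e * w) := h2 ▸ isIdempotentElem_conj he w⁻¹
  exact hF.eq_of_eq_mul_unit h3 he rfl

theorem mul_inv_eq_mul_inv {e : R} (he : IsIdempotentElem e) {a b : Rˣ}
    (h : (a : R) * e = b * e) : e * (a⁻¹ : Rˣ) = e * (b⁻¹ : Rˣ) := by
  have h1 : ((b⁻¹ * a : Rˣ) : R) * e = e := by
    rw [Units.val_mul, mul_assoc, h]; simp
  have h2 := hF.mul_unit_eq_self he h1
  rw [Units.mul_inv_eq_iff_eq_mul, mul_assoc, ← Units.val_mul, h2]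

theorem conj_eq_conj {e : R} (he : IsIdempotentElem e) {a b : Rˣ}
    (h : (a : R) * e = b * e) : (a : R) * e * (a⁻¹ : Rˣ) = b * e * (b⁻¹ : Rˣ) := by
  have he' : e * e = e := he
  have key : ∀ c : Rˣ, (c : R) * e * (c⁻¹ : Rˣ) = (c * e) * (e * (c⁻¹ : Rˣ)) := fun c => by
    rw [← mul_assoc, mul_assoc (c : R) e e, he']
  rw [key, key, h, hF.mul_inv_eq_mul_inv he h]

/-- The range idempotents of two factorizations of the same element agree. -/
theorem conj_eq_of_mul_eq_mul {e f : R} (he : IsIdempotentElem e) (hf : IsIdempotentElem f)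
    {a b c d : Rˣ} (h : (a : R) * e * b = c * f * d) :
    (a : R) * e * (a⁻¹ : Rˣ) = c * f * (c⁻¹ : Rˣ) := by
  apply hF.eq_of_eq_mul_unit (isIdempotentElem_conj he a)
    (isIdempotentElem_conj hf c) (w := c * d * (b⁻¹ * a⁻¹))
  have h' : (a : R) * e = c * f * d * (b⁻¹ : Rˣ) := by rw [← h]; simp
  rw [h']
  simp [mul_assoc]

/-- The domain idempotents of two factorizations of the same element agree. -/
theorem conj_eq_of_mul_eq_mul' {e f : R} (he : IsIdempotentElem e) (hf : IsIdempotentElem f)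
    {a b c d : Rˣ} (h : (a : R) * e * b = c * f * d) :
    ((b⁻¹ : Rˣ) : R) * e * b = (d⁻¹ : Rˣ) * f * d := by
  have h1 := isIdempotentElem_conj he b⁻¹
  have h2 := isIdempotentElem_conj hf d⁻¹
  rw [inv_inv] at h1 h2
  apply hF.eq_of_eq_unit_mul h1 h2 (w := b⁻¹ * a⁻¹ * (c * d))
  have h' : e * b = (a⁻¹ : Rˣ) * (c * f * d) := by rw [← h]; simp [mul_assoc]
  rw [mul_assoc, h']
  simp [mul_assoc]

/-! ### Green's relations as orbits of the unit group -/

/-- Up to left units both elements are idempotents, and mutual divisibility makes these absorb each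
other. -/
theorem greenL_iff {r t : R} : greenL R r t ↔ ∃ w : Rˣ, t = w * r := by
  constructor
  · intro h
    have h' : (Set.range fun a : R => a * r) = Set.range fun a : R => a * t := h
    obtain ⟨w, e, he, rfl⟩ := hF.eq_unit_mul_idem r
    obtain ⟨u, f, hf, rfl⟩ := hF.eq_unit_mul_idem t
    have he' : e * e = e := he
    have hf' : f * f = f := hf
    obtain ⟨a, ha⟩ : (e : R) ∈ Set.range fun a : R => a * ((u : R) * f) :=
      h' ▸ ⟨(w⁻¹ : Rˣ), by simp⟩
    obtain ⟨b, hb⟩ : (f : R) ∈ Set.range fun a : R => a * ((w : R) * e) :=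
      h' ▸ ⟨(u⁻¹ : Rˣ), by simp⟩
    have h1 : e * f = e := by
      simp only at ha
      rw [← ha, mul_assoc, mul_assoc, hf']
    have h2 : f * e = f := by
      simp only at hb
      rw [← hb, mul_assoc, mul_assoc, he']
    have : e = f := by rw [← h1, hF.idem_comm e f he hf, h2]
    subst this
    exact ⟨u * w⁻¹, by simp [mul_assoc]⟩
  · rintro ⟨w, rfl⟩
    change (Set.range fun a : R => a * r) = Set.range fun a : R => a * (w * r)
    ext x
    constructor
    · rintro ⟨a, rfl⟩
      exact ⟨a * (w⁻¹ : Rˣ), by simp [mul_assoc]⟩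
    · rintro ⟨a, rfl⟩
      exact ⟨a * w, by simp [mul_assoc]⟩

theorem greenR_iff {r t : R} : greenR R r t ↔ ∃ w : Rˣ, t = r * w := by
  constructor
  · intro h
    have h' : (Set.range fun a : R => r * a) = Set.range fun a : R => t * a := h
    obtain ⟨e, w, he, rfl⟩ := hF.eq_idem_mul_unit r
    obtain ⟨f, u, hf, rfl⟩ := hF.eq_idem_mul_unit t
    have he' : e * e = e := he
    have hf' : f * f = f := hf
    obtain ⟨a, ha⟩ : (e : R) ∈ Set.range fun a : R => f * (u : R) * a :=
      h' ▸ ⟨(w⁻¹ : Rˣ), by simp⟩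
    obtain ⟨b, hb⟩ : (f : R) ∈ Set.range fun a : R => e * (w : R) * a :=
      h' ▸ ⟨(u⁻¹ : Rˣ), by simp⟩
    have h1 : f * e = e := by
      simp only at ha
      rw [← ha, ← mul_assoc, ← mul_assoc, hf']
    have h2 : e * f = f := by
      simp only at hb
      rw [← hb, ← mul_assoc, ← mul_assoc, he']
    have : e = f := by rw [← h1, hF.idem_comm f e hf he, h2]
    subst this
    exact ⟨w⁻¹ * u, by simp [mul_assoc]⟩
  · rintro ⟨w, rfl⟩
    change (Set.range fun a : R => r * a) = Set.range fun a : R => r * w * a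
    ext x
    constructor
    · rintro ⟨a, rfl⟩
      exact ⟨(w⁻¹ : Rˣ) * a, by simp [mul_assoc]⟩
    · rintro ⟨a, rfl⟩
      exact ⟨w * a, by simp [mul_assoc]⟩

theorem greenH_iff {r t : R} :
    greenH R r t ↔ (∃ w : Rˣ, t = w * r) ∧ ∃ w : Rˣ, t = r * w := by
  rw [← hF.greenL_iff, ← hF.greenR_iff]
  rfl

/-- If `e ∈ R f R` for idempotents `e` and `f`, then `e` is conjugate to an idempotent below
`f`. -/
theorem exists_conj_le {e f a b : R} (he : IsIdempotentElem e) (hf : IsIdempotentElem f)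
    (h : e = a * f * b) : ∃ w : Rˣ, idemLE ((w : R) * e * (w⁻¹ : Rˣ)) f := by
  have hf' : f * f = f := hf
  -- Peel off units: `a f = w g` with `g ≤ f`, then `g b = k v` with `k ≤ g`. Thus `e = w k v`,
  -- which forces `e = w k w⁻¹`.
  obtain ⟨w, g, hg, hw⟩ := hF.eq_unit_mul_idem (a * f)
  obtain ⟨k, v, hk, hv⟩ := hF.eq_idem_mul_unit (g * b)
  have hg' : g * g = g := hg
  have hgf : g * f = g := by
    have h1 : (w : R) * (g * f) = w * g := by
      rw [← mul_assoc, ← hw, mul_assoc, hf']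
    exact (Units.mul_right_inj w).1 h1
  have hgk : g * k = k := by
    have h1 : g * k * v = k * v := by rw [mul_assoc, ← hv, ← mul_assoc, hg']
    exact (Units.mul_left_inj v).1 h1
  have hfk : f * k = k := by
    rw [← hgk, ← mul_assoc, hF.idem_comm f g hf hg, hgf]
  have hek : e = w * k * (w⁻¹ : Rˣ) * (w * v : Rˣ) := by
    rw [h, hw, mul_assoc, hv]
    simp [mul_assoc]
  have hek' := hF.eq_of_eq_mul_unit he (isIdempotentElem_conj hk w) hek
  refine ⟨w⁻¹, ?_⟩
  have : ((w⁻¹ : Rˣ) : R) * e * (w⁻¹⁻¹ : Rˣ) = k := by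
    rw [hek']; simp [mul_assoc]
  rw [this]
  exact ⟨by rw [hF.idem_comm k f hk hf, hfk], hfk⟩

/-- In a product `e c f` the meet of `e` and `c f c⁻¹` is the part that survives; the last two
clauses transport it through `c` to an idempotent below `f`. -/
theorem idemLE_mul_conj {e f : R} (he : IsIdempotentElem e) (hf : IsIdempotentElem f) (c : Rˣ) :
    IsIdempotentElem (e * (c * f * (c⁻¹ : Rˣ))) ∧ idemLE (e * (c * f * (c⁻¹ : Rˣ))) e ∧
      IsIdempotentElem (((c⁻¹ : Rˣ) : R) * (e * (c * f * (c⁻¹ : Rˣ))) * c) ∧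
      idemLE (((c⁻¹ : Rˣ) : R) * (e * (c * f * (c⁻¹ : Rˣ))) * c) f := by
  have hq := isIdempotentElem_conj hf c
  have hqf : f = ((c⁻¹ : Rˣ) : R) * (c * f * (c⁻¹ : Rˣ)) * c := by simp [mul_assoc]
  generalize (c : R) * f * (c⁻¹ : Rˣ) = q at hq hqf ⊢
  have heq := hF.idem_comm e q he hq
  have hee : e * e = e := he
  have hqq : q * q = q := hq
  have hk : IsIdempotentElem (e * q) := by
    rw [IsIdempotentElem]
    calc e * q * (e * q) = e * (q * e) * q := by simp only [mul_assoc]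
      _ = (e * e) * (q * q) := by rw [← heq]; simp only [mul_assoc]
      _ = e * q := by rw [hee, hqq]
  have hk' := isIdempotentElem_conj hk c⁻¹
  rw [inv_inv] at hk'
  refine ⟨hk, ⟨by rw [mul_assoc, ← heq, ← mul_assoc, hee], by rw [← mul_assoc, hee]⟩, hk', ?_, ?_⟩
  · calc ((c⁻¹ : Rˣ) : R) * (e * q) * c * f = (c⁻¹ : Rˣ) * (e * (q * q)) * c := by
          rw [hqf]; simp [mul_assoc]
      _ = _ := by rw [hqq]
  · calc f * (((c⁻¹ : Rˣ) : R) * (e * q) * c) = (c⁻¹ : Rˣ) * (q * e * q) * c := by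
          rw [hqf]; simp [mul_assoc]
      _ = _ := by rw [← heq, mul_assoc e, hqq]

theorem isInverseOf_unique {m n n' : R} (h : IsInverseOf m n) (h' : IsInverseOf m n') :
    n = n' := by
  obtain ⟨h1, h2⟩ := h
  obtain ⟨h3, h4⟩ := h'
  have i1 : IsIdempotentElem (n * m) := by
    rw [IsIdempotentElem, ← mul_assoc, h2]
  have i2 : IsIdempotentElem (n' * m) := by
    rw [IsIdempotentElem, ← mul_assoc, h4]
  have i3 : IsIdempotentElem (m * n) := by
    rw [IsIdempotentElem, ← mul_assoc, h1]
  have i4 : IsIdempotentElem (m * n') := by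
    rw [IsIdempotentElem, ← mul_assoc, h3]
  calc n = n * (m * n' * m) * n := by rw [h3, h2]
    _ = (n * m) * (n' * m) * n := by simp only [mul_assoc]
    _ = (n' * m) * (n * m) * n := by rw [hF.idem_comm _ _ i1 i2]
    _ = n' * (m * n * m) * n := by simp only [mul_assoc]
    _ = n' * m * n' * (m * n) := by rw [h1, h4, mul_assoc]
    _ = n' * ((m * n') * (m * n)) := by simp only [mul_assoc]
    _ = n' * ((m * n) * (m * n')) := by rw [hF.idem_comm _ _ i3 i4]
    _ = n' * (m * n * m * n') := by simp only [mul_assoc]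
    _ = n' := by rw [h1, ← mul_assoc, h4]

end IsFactorizable

/-! ### The inversion `r ↦ r*` -/

theorem isInverseOf_form {e : R} (he : IsIdempotentElem e) (a b : Rˣ) :
    IsInverseOf ((a : R) * e * b) ((b⁻¹ : Rˣ) * e * (a⁻¹ : Rˣ)) := by
  have he' : e * e = e := he
  have he'' : ∀ x, e * (e * x) = e * x := fun x => by rw [← mul_assoc, he']
  constructor <;> simp [mul_assoc, he'']

open Classical in
/-- The inverse `r*` of `r`. -/
noncomputable def starInv (r : R) : R :=
  -- In a factorizable monoid every element has an inverse, so the default `r` is never taken.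
  if h : ∃ n, IsInverseOf r n then h.choose else r

namespace IsFactorizable

variable (hF : IsFactorizable R)
include hF

theorem isInverseOf_starInv (r : R) : IsInverseOf r (starInv r) := by
  have h : ∃ n, IsInverseOf r n := by
    obtain ⟨e, w, he, rfl⟩ := hF.eq_idem_mul_unit r
    exact ⟨_, by simpa using isInverseOf_form he 1 w⟩
  rw [starInv, dif_pos h]
  exact h.choose_spec

theorem starInv_eq {r n : R} (h : IsInverseOf r n) : starInv r = n :=
  hF.isInverseOf_unique (hF.isInverseOf_starInv r) h

theorem starInv_form {e : R} (he : IsIdempotentElem e) (a b : Rˣ) :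
    starInv ((a : R) * e * b) = (b⁻¹ : Rˣ) * e * (a⁻¹ : Rˣ) :=
  hF.starInv_eq (isInverseOf_form he a b)

theorem starInv_starInv (r : R) : starInv (starInv r) = r :=
  hF.starInv_eq ⟨(hF.isInverseOf_starInv r).2, (hF.isInverseOf_starInv r).1⟩

/-- Writing `r = e w` and `s = u f` lets the units meet, so that the product is the idempotent `e (c
f c⁻¹)` times the unit `c = w u`. -/
theorem starInv_mul (r s : R) : starInv (r * s) = starInv s * starInv r := by
  obtain ⟨e, w, he, rfl⟩ := hF.eq_idem_mul_unit r
  obtain ⟨u, f, hf, rfl⟩ := hF.eq_unit_mul_idem s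
  have h1 : starInv (e * (w : R)) = (w⁻¹ : Rˣ) * e := by
    simpa using hF.starInv_form he 1 w
  have h2 : starInv ((u : R) * f) = f * (u⁻¹ : Rˣ) := by
    simpa using hF.starInv_form hf u 1
  rw [h1, h2]
  apply hF.starInv_eq
  set c : Rˣ := w * u with hc
  have hg := isIdempotentElem_conj hf c
  set g := (c : R) * f * (c⁻¹ : Rˣ) with hgd
  have i : IsIdempotentElem (e * g) := by
    rw [IsIdempotentElem]
    calc e * g * (e * g) = e * (g * e) * g := by simp only [mul_assoc]
      _ = (e * e) * (g * g) := by rw [hF.idem_comm g e hg he]; simp only [mul_assoc]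
      _ = e * g := by rw [show e * e = e from he, show g * g = g from hg]
  have e1 : e * (w : R) * ((u : R) * f) = (1 : Rˣ) * (e * g) * c := by
    simp [hgd, hc, mul_assoc]
  have e2 : f * (u⁻¹ : Rˣ) * ((w⁻¹ : Rˣ) * e) = (c⁻¹ : Rˣ) * (e * g) * (1⁻¹ : Rˣ) := by
    rw [hF.idem_comm e g he hg]
    simp [hgd, hc, mul_assoc]
  rw [e1, e2]
  exact isInverseOf_form i 1 c

theorem starInv_unit (w : Rˣ) : starInv (w : R) = (w⁻¹ : Rˣ) := by
  have := hF.starInv_form (e := (1 : R)) IsIdempotentElem.one w 1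
  simpa using this

theorem greenL_iff_greenR_starInv {r t : R} :
    greenL R r t ↔ greenR R (starInv r) (starInv t) := by
  rw [hF.greenL_iff, hF.greenR_iff]
  constructor
  · rintro ⟨w, rfl⟩
    exact ⟨w⁻¹, by rw [hF.starInv_mul, hF.starInv_unit]⟩
  · rintro ⟨w, h⟩
    refine ⟨w⁻¹, ?_⟩
    rw [← hF.starInv_starInv t, h, hF.starInv_mul, hF.starInv_unit, hF.starInv_starInv]

theorem greenR_iff_greenL_starInv {r t : R} :
    greenR R r t ↔ greenL R (starInv r) (starInv t) := by
  rw [hF.greenL_iff_greenR_starInv, hF.starInv_starInv, hF.starInv_starInv]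

theorem greenH_iff_starInv {r t : R} : greenH R r t ↔ greenH R (starInv r) (starInv t) :=
  ⟨fun h => ⟨hF.greenR_iff_greenL_starInv.1 h.2, hF.greenL_iff_greenR_starInv.1 h.1⟩,
    fun h => ⟨hF.greenL_iff_greenR_starInv.2 h.2, hF.greenR_iff_greenL_starInv.2 h.1⟩⟩

theorem starSet_eq (A : Set R) : starSet A = {r | starInv r ∈ A} := by
  ext n
  constructor
  · rintro ⟨m, hm, h⟩
    rw [Set.mem_ofPred_eq, hF.starInv_eq ⟨h.2, h.1⟩]
    exact hm
  · intro h
    exact ⟨_, h, (hF.isInverseOf_starInv n).2, (hF.isInverseOf_starInv n).1⟩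

end IsFactorizable

end Factorizable

namespace IsRennerCoxeterSystem

variable {R : Type u} [Monoid R] {B : Type v} {M : CoxeterMatrix B} {cs : CoxeterSystem M Rˣ}
  {Λ : Set R} (hR : IsRennerCoxeterSystem cs Λ)
include hR

/-! ### Parabolic subgroups attached to the elements of `Λ` -/

theorem mul_self {e : R} (he : e ∈ Λ) : e * e = e := hR.idem e he

/-- The axiom supplies some index set `I`; its simple reflections centralize `e`, so `I ⊆ λ(e)`, and
`W_λ(e)` is squeezed between `W_I` and the centralizer. -/
theorem mem_centralizer_iff {e : R} (he : e ∈ Λ) {w : Rˣ} :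
    w ∈ parabolic cs (typeMap cs e) ↔ (w : R) * e = e * w := by
  obtain ⟨I, hI⟩ := hR.centralizer_parabolic e he
  constructor
  · intro h
    rw [← hI]
    exact (parabolic_le_iff cs).2 (fun i hi => (hI _).2 hi) h
  · intro h
    exact parabolic_mono cs (fun i hi => (hI _).1 (simple_mem_parabolic cs hi)) ((hI w).2 h)

theorem mem_stabilizer_iff {e : R} (he : e ∈ Λ) {w : Rˣ} :
    w ∈ parabolic cs (lowerType cs e) ↔ (w : R) * e = e := by
  obtain ⟨I, hI⟩ := hR.stabilizer_parabolic e he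
  constructor
  · intro h
    exact ((hI w).1 ((parabolic_le_iff cs).2 (fun i hi => (hI _).2 hi) h)).2
  · intro h
    refine parabolic_mono cs (fun i hi => (hI _).1 (simple_mem_parabolic cs hi)) ((hI w).2 ⟨?_, h⟩)
    rw [h, hR.factorizable.mul_unit_eq_self (hR.idem e he) h]

omit hR in
theorem lowerType_subset (e : R) : lowerType cs e ⊆ typeMap cs e := fun _ h => h.1

omit hR in
theorem upperType_subset (e : R) : upperType cs e ⊆ typeMap cs e := fun _ h => h.1

omit hR in
theorem typeMap_eq_union (e : R) : typeMap cs e = lowerType cs e ∪ upperType cs e := by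
  ext i
  constructor
  · intro h
    by_cases h' : (cs.simple i : R) * e = e
    exacts [Or.inl ⟨h, h'⟩, Or.inr ⟨h, h'⟩]
  · rintro (h | h)
    exacts [h.1, h.1]

/-- As `s_j` commutes with `e`, it normalizes the stabilizer `W_λ_*(e)`, to which it does not
belong. -/
theorem simple_commute {e : R} (he : e ∈ Λ) {i j : B} (hi : i ∈ lowerType cs e)
    (hj : j ∈ upperType cs e) : cs.simple i * cs.simple j = cs.simple j * cs.simple i := by
  apply simple_commute_of_conj_mem (I := lowerType cs e) (simple_mem_parabolic cs hi)
  · rw [hR.mem_stabilizer_iff he]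
    exact hj.2
  · rw [hR.mem_stabilizer_iff he, Units.val_mul, Units.val_mul, mul_assoc, hj.1, ← mul_assoc,
      mul_assoc (cs.simple j : R), hi.2, hj.1, mul_assoc, ← Units.val_mul,
      cs.simple_mul_simple_self, Units.val_one, mul_one]

theorem mem_stabilizer_of_isRightMin {e : R} (he : e ∈ Λ) {a : Rˣ}
    (ha : a ∈ parabolic cs (typeMap cs e)) (h : IsRightMin cs (upperType cs e) a) :
    (a : R) * e = e := by
  rw [← hR.mem_stabilizer_iff he]
  rw [typeMap_eq_union] at ha
  exact mem_parabolic_of_isRightMin (fun i hi j hj => hR.simple_commute he hi hj) ha h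

theorem eq_of_conj {e f : R} (he : e ∈ Λ) (hf : f ∈ Λ) {w : Rˣ}
    (h : (w : R) * e * (w⁻¹ : Rˣ) = f) : e = f :=
  (hR.transversal e (hR.idem e he)).unique ⟨he, 1, by simp⟩ ⟨hf, w, h⟩

theorem eq_of_conj_eq_conj {e f : R} (he : e ∈ Λ) (hf : f ∈ Λ) {a b : Rˣ}
    (h : (a : R) * e * (a⁻¹ : Rˣ) = b * f * (b⁻¹ : Rˣ)) : e = f := by
  apply hR.eq_of_conj he hf (w := b⁻¹ * a)
  calc ((b⁻¹ * a : Rˣ) : R) * e * ((b⁻¹ * a)⁻¹ : Rˣ) =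
        (b⁻¹ : Rˣ) * (a * e * (a⁻¹ : Rˣ)) * b := by simp [mul_assoc]
    _ = f := by rw [h]; simp [mul_assoc]

theorem one_mem : (1 : R) ∈ Λ := by
  obtain ⟨f, ⟨hf, w, hw⟩, -⟩ := hR.transversal 1 IsIdempotentElem.one
  have : f = 1 := by rw [← hw]; simp
  exact this ▸ hf

/-- Conjugate the comparable pair simultaneously into `Λ`; by transversality the result is the pair
`e`, `f` itself. -/
theorem idemLE_of_conj {e f : R} (he : e ∈ Λ) (hf : f ∈ Λ) {w : Rˣ}
    (h : idemLE ((w : R) * e * (w⁻¹ : Rˣ)) f) : idemLE e f := by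
  obtain ⟨u, g, hg, g', hg', hle, h1, h2⟩ :=
    hR.exists_conj _ _ (isIdempotentElem_conj (hR.idem e he) w) (hR.idem f hf) h
  have e2 := hR.eq_of_conj hf hg' h2
  have e1 : e = g := hR.eq_of_conj he hg (w := u * w) (by rw [← h1]; simp [mul_assoc])
  rw [e1, e2]
  exact hle

omit hR in
theorem eq_of_idemLE {e f : R} (h : idemLE e f) (h' : idemLE f e) : e = f := by
  rw [← h.1, h'.2]

theorem exists_form (r : R) : ∃ e ∈ Λ, ∃ u v : Rˣ, r = u * e * v := by
  obtain ⟨g, w, hg, rfl⟩ := hR.factorizable.eq_idem_mul_unit r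
  obtain ⟨e, ⟨he, u, hu⟩, -⟩ := hR.transversal g hg
  refine ⟨e, he, u⁻¹, u * w, ?_⟩
  rw [← hu]
  simp [mul_assoc]

/-- Mutual divisibility bounds the representatives in `Λ` by each other, so they coincide. -/
theorem greenJ_iff {r t : R} : greenJ R r t ↔ ∃ a b : Rˣ, t = a * r * b := by
  have hF := hR.factorizable
  constructor
  · intro h
    have h' : (Set.range fun p : R × R => p.1 * r * p.2) =
      Set.range fun p : R × R => p.1 * t * p.2 := h
    obtain ⟨e, he, u, v, rfl⟩ := hR.exists_form r
    obtain ⟨f, hf, u', v', rfl⟩ := hR.exists_form t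
    obtain ⟨⟨a, b⟩, hab⟩ : e ∈ Set.range fun p : R × R => p.1 * ((u' : R) * f * v') * p.2 :=
      h' ▸ ⟨((u⁻¹ : Rˣ), (v⁻¹ : Rˣ)), by simp [mul_assoc]⟩
    obtain ⟨⟨c, d⟩, hcd⟩ : f ∈ Set.range fun p : R × R => p.1 * ((u : R) * e * v) * p.2 :=
      h' ▸ ⟨((u'⁻¹ : Rˣ), (v'⁻¹ : Rˣ)), by simp [mul_assoc]⟩
    obtain ⟨w, hw⟩ := hF.exists_conj_le (a := a * u') (b := v' * b) (hR.idem e he)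
      (hR.idem f hf) (by simp only at hab; rw [← hab]; simp [mul_assoc])
    obtain ⟨w', hw'⟩ := hF.exists_conj_le (a := c * u) (b := v * d) (hR.idem f hf)
      (hR.idem e he) (by simp only at hcd; rw [← hcd]; simp [mul_assoc])
    have := eq_of_idemLE (hR.idemLE_of_conj he hf hw) (hR.idemLE_of_conj hf he hw')
    subst this
    exact ⟨u' * u⁻¹, v⁻¹ * v', by simp [mul_assoc]⟩
  · rintro ⟨a, b, rfl⟩
    change (Set.range fun p : R × R => p.1 * r * p.2) =
      Set.range fun p : R × R => p.1 * (a * r * b) * p.2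
    ext x
    constructor
    · rintro ⟨⟨c, d⟩, rfl⟩
      exact ⟨(c * (a⁻¹ : Rˣ), (b⁻¹ : Rˣ) * d), by simp [mul_assoc]⟩
    · rintro ⟨⟨c, d⟩, rfl⟩
      exact ⟨(c * a, b * d), by simp [mul_assoc]⟩

theorem greenJ_iff_starInv {r t : R} : greenJ R r t ↔ greenJ R (starInv r) (starInv t) := by
  have hF := hR.factorizable
  have key : ∀ r t : R, greenJ R r t → greenJ R (starInv r) (starInv t) := by
    intro r t h
    obtain ⟨a, b, rfl⟩ := hR.greenJ_iff.1 h
    rw [hR.greenJ_iff]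
    refine ⟨b⁻¹, a⁻¹, ?_⟩
    rw [hF.starInv_mul, hF.starInv_mul, hF.starInv_unit, hF.starInv_unit, mul_assoc]
  refine ⟨key r t, fun h => ?_⟩
  have := key _ _ h
  rwa [hF.starInv_starInv, hF.starInv_starInv] at this

/-! ### Standard forms -/

omit hR in
theorem isLeftStandard_iff {x : Rˣ} {e : R} {y : Rˣ} {r : R} :
    IsLeftStandard cs Λ x e y r ↔ r = x * e * y ∧ e ∈ Λ ∧ IsRightMin cs (lowerType cs e) x ∧
      IsLeftMin cs (typeMap cs e) y := by
  rw [IsLeftStandard, mem_minReps_empty_left, mem_minReps_empty_right]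

omit hR in
theorem isRightStandard_iff {x : Rˣ} {e : R} {y : Rˣ} {r : R} :
    IsRightStandard cs Λ y e x r ↔ r = y * e * x ∧ e ∈ Λ ∧ IsRightMin cs (typeMap cs e) y ∧
      IsLeftMin cs (lowerType cs e) x := by
  rw [IsRightStandard, mem_minReps_empty_left, mem_minReps_empty_right]

/-- The range idempotent determines `e`, the domain idempotent determines `y` modulo the centralizer
of `e`, and then `x` is determined modulo its stabilizer. -/
theorem leftStandard_unique {x x' y y' : Rˣ} {e e' r : R} (h : IsLeftStandard cs Λ x e y r)
    (h' : IsLeftStandard cs Λ x' e' y' r) : x = x' ∧ e = e' ∧ y = y' := by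
  have hF := hR.factorizable
  rw [isLeftStandard_iff] at h h'
  obtain ⟨h1, he, hx, hy⟩ := h
  obtain ⟨h2, he', hx', hy'⟩ := h'
  have hxy : (x : R) * e * y = x' * e' * y' := h1.symm.trans h2
  have := hR.eq_of_conj_eq_conj he he'
    (hF.conj_eq_of_mul_eq_mul (hR.idem e he) (hR.idem e' he') hxy)
  subst this
  have hd := hF.conj_eq_of_mul_eq_mul' (hR.idem e he) (hR.idem e he) hxy
  have hyy : y = y' := by
    have hc : ((y⁻¹ : Rˣ) : R) * e * (y⁻¹⁻¹ : Rˣ) = (y'⁻¹ : Rˣ) * e * (y'⁻¹⁻¹ : Rˣ) := by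
      simpa using hd
    rw [conj_eq_conj_iff, ← hR.mem_centralizer_iff he] at hc
    exact inv_injective
      ((isRightMin_inv.2 hy).eq_of_inv_mul_mem (isRightMin_inv.2 hy') hc)
  subst hyy
  refine ⟨?_, rfl, rfl⟩
  apply hx.eq_of_inv_mul_mem hx'
  rw [hR.mem_stabilizer_iff he, Units.val_mul, mul_assoc, ← (Units.mul_left_inj y).1 hxy]
  simp

theorem mul_eq_mul_of_mem_stabilizer {e : R} (he : e ∈ Λ) (x : Rˣ) {p : Rˣ}
    (hp : p ∈ parabolic cs (lowerType cs e)) : ((x * p : Rˣ) : R) * e = x * e := by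
  rw [Units.val_mul, mul_assoc, (hR.mem_stabilizer_iff he).1 hp]

theorem mul_eq_mul_of_mem_centralizer {e : R} (he : e ∈ Λ) (x y : Rˣ) {p : Rˣ}
    (hp : p ∈ parabolic cs (typeMap cs e)) :
    (x : R) * e * (p * y : Rˣ) = (x * p : Rˣ) * e * y := by
  rw [Units.val_mul, Units.val_mul, mul_assoc (x : R) (p : R), (hR.mem_centralizer_iff he).1 hp]
  simp only [mul_assoc]

/-- The centralizer part of `v` is moved across `e` and the stabilizer part is absorbed. The form `u
p` records that the left factor stays in `u W_λ(e)`, which the comparisons inside an 𝓡-class need.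
-/
theorem exists_leftStandard {e : R} (he : e ∈ Λ) (u v : Rˣ) :
    ∃ p ∈ parabolic cs (typeMap cs e), ∃ y : Rˣ,
      IsLeftStandard cs Λ (u * p) e y ((u : R) * e * v) := by
  obtain ⟨a, ha, y, hy, rfl⟩ := exists_minimal_mul (cs := cs) (I := typeMap cs e) v
  obtain ⟨m, hm, d, hd, h⟩ := exists_mul_minimal (cs := cs) (I := lowerType cs e) (u * a)
  have hm' : m = u * (a * d⁻¹) := by
    rw [← mul_assoc, h, mul_inv_cancel_right]
  refine ⟨a * d⁻¹, Subgroup.mul_mem _ ha (inv_mem (parabolic_mono cs (lowerType_subset e) hd)), y, ?_⟩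
  rw [isLeftStandard_iff, ← hm']
  refine ⟨?_, he, hm, hy⟩
  rw [hR.mul_eq_mul_of_mem_centralizer he u y ha, h, hR.mul_eq_mul_of_mem_stabilizer he m hd]

/-! ### The submonoids `O` and `G` -/

omit hR in
variable (cs Λ) in
/-- The elements `x e y` with `e ∈ Λ`, `x` shortest in `x W_{λ(e)}` and `y` shortest in
`W_{λ(e)} y`. -/
def orderPreserving : Set R :=
  {r | ∃ e ∈ Λ, ∃ x y : Rˣ, IsRightMin cs (typeMap cs e) x ∧ IsLeftMin cs (typeMap cs e) y ∧
    r = x * e * y}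

omit hR in
variable (cs Λ) in
/-- The elements `e y` with `e ∈ Λ` and `y` shortest in `W_{λ(e)} y`. -/
def gaussJordan : Set R :=
  {r | ∃ e ∈ Λ, ∃ y : Rˣ, IsLeftMin cs (typeMap cs e) y ∧ r = e * y}

omit hR in
theorem gaussJordan_subset : gaussJordan cs Λ ⊆ orderPreserving cs Λ := by
  rintro _ ⟨e, he, y, hy, rfl⟩
  exact ⟨e, he, 1, y, isRightMin_one _, hy, by simp⟩

/-- Only `λ^*(h)` must be free of descents: the part of `u` in `W_λ(h)` then lies in `W_λ_*(h)` and
is absorbed by `h`. -/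
theorem exists_isRightMin_mul_eq {h : R} (hh : h ∈ Λ) {u : Rˣ}
    (hu : IsRightMin cs (upperType cs h) u) :
    ∃ m, IsRightMin cs (typeMap cs h) m ∧ (u : R) * h = m * h := by
  obtain ⟨m, hm, a, ha, rfl⟩ := exists_mul_minimal (cs := cs) (I := typeMap cs h) u
  refine ⟨m, hm, ?_⟩
  have := hR.mem_stabilizer_of_isRightMin hh ha (hu.of_mul (hm a ha))
  rw [Units.val_mul, mul_assoc, this]

/-- Idempotents below `e ∈ Λ` are conjugates of elements of `Λ` by elements that preserve
minimality. -/
theorem exists_restriction {e k : R} (he : e ∈ Λ) (hk : IsIdempotentElem k) (hke : idemLE k e) :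
    ∃ h ∈ Λ, ∃ v : Rˣ, k = v * h * (v⁻¹ : Rˣ) ∧
      ∀ x, IsRightMin cs (typeMap cs e) x →
        ∃ m, IsRightMin cs (typeMap cs h) m ∧ ((x * v : Rˣ) : R) * h = m * h := by
  obtain ⟨w, h, hh, g, hg, hle, h1, h2⟩ := hR.exists_conj k e hk (hR.idem e he) hke
  have := hR.eq_of_conj he hg h2
  subst this
  have hw : w ∈ parabolic cs (typeMap cs e) :=
    (hR.mem_centralizer_iff he).2 (conj_eq_iff_commute.1 h2)
  -- Monotonicity of `λ^*` enters here: since `λ^*(h) ⊆ λ(e)`, a shortest `x` modulo `W_λ(e)`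
  -- creates no descents of `x v` in `λ^*(h)`.
  have hup : upperType cs h ⊆ typeMap cs e :=
    (hR.upperType_mono h hh e he hle).trans (upperType_subset e)
  obtain ⟨v, hv, c, hc, hwc⟩ := exists_mul_minimal (cs := cs) (I := typeMap cs h) w⁻¹
  have hvI : v ∈ parabolic cs (typeMap cs e) := by
    have h3 : v * c ∈ parabolic cs (typeMap cs e) := hwc ▸ inv_mem hw
    exact (mem_parabolic_of_length_mul cs h3 (hv c hc)).1
  refine ⟨h, hh, v, ?_, ?_⟩
  · have h4 : (v : R) * h * (v⁻¹ : Rˣ) = (w⁻¹ : Rˣ) * h * (w⁻¹⁻¹ : Rˣ) := by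
      rw [conj_eq_conj_iff, ← hR.mem_centralizer_iff hh, hwc, inv_mul_cancel_left]
      exact hc
    rw [h4, ← h1]
    simp [mul_assoc]
  · intro x hx
    exact hR.exists_isRightMin_mul_eq hh (hx.mul hup hvI (hv.mono (upperType_subset h)))

/-- With `c = y x'`, the product only sees the restrictions of its factors to `k = e (c f c⁻¹)` and
`k' = c⁻¹ k c`, both conjugate to one `h ∈ Λ`. The restrictions are `m1 h m2⁻¹` and `m3 h m4⁻¹` with
all `m` shortest modulo `W_λ(h)`, and the middle cancels. -/
theorem orderPreserving_mul {r s : R} (hr : r ∈ orderPreserving cs Λ)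
    (hs : s ∈ orderPreserving cs Λ) : r * s ∈ orderPreserving cs Λ := by
  have hF := hR.factorizable
  obtain ⟨e, he, x, y, hx, hy, rfl⟩ := hr
  obtain ⟨f, hf, x', y', hx', hy', rfl⟩ := hs
  have hee := hR.mul_self he
  have hff := hR.mul_self hf
  set c : Rˣ := y * x' with hc
  set q := (c : R) * f * (c⁻¹ : Rˣ) with hqd
  obtain ⟨hk, hke, hk', hkf⟩ := hF.idemLE_mul_conj (hR.idem e he) (hR.idem f hf) c
  rw [← hqd] at hk hke hk' hkf
  set k := e * q with hkd
  set k' := ((c⁻¹ : Rˣ) : R) * k * c with hkd'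
  obtain ⟨h, hh, v, hkv, hv⟩ := hR.exists_restriction he hk hke
  obtain ⟨h', hh', v', hkv', hv'⟩ := hR.exists_restriction hf hk' hkf
  have hhi := hR.idem h hh
  have hhh := hR.mul_self hh
  have : h' = h := by
    apply hR.eq_of_conj_eq_conj hh' hh (a := c * v') (b := v)
    rw [← hkv]
    calc ((c * v' : Rˣ) : R) * h' * ((c * v')⁻¹ : Rˣ) =
          c * (v' * h' * (v'⁻¹ : Rˣ)) * (c⁻¹ : Rˣ) := by simp [mul_assoc]
      _ = k := by rw [← hkv', hkd']; simp [mul_assoc]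
  subst this
  obtain ⟨m1, hm1, e1⟩ := hv x hx
  obtain ⟨m2, hm2, e2⟩ := hv y⁻¹ (isRightMin_inv.2 hy)
  obtain ⟨m3, hm3, e3⟩ := hv' x' hx'
  obtain ⟨m4, hm4, e4⟩ := hv' y'⁻¹ (isRightMin_inv.2 hy')
  have e2' := hF.mul_inv_eq_mul_inv hhi e2
  have e4' := hF.mul_inv_eq_mul_inv hhi e4
  -- Both carry `h` to the same idempotent `y⁻¹ k y = x' k' x'⁻¹`, and both are shortest modulo the
  -- centralizer of `h`.
  have hm23 : m2 = m3 := by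
    apply hm2.eq_of_inv_mul_mem hm3
    rw [hR.mem_centralizer_iff hh, ← conj_eq_conj_iff, ← hF.conj_eq_conj hhi e2,
      ← hF.conj_eq_conj hhi e3]
    calc ((y⁻¹ * v : Rˣ) : R) * h' * ((y⁻¹ * v)⁻¹ : Rˣ) =
          (y⁻¹ : Rˣ) * (v * h' * (v⁻¹ : Rˣ)) * y := by simp [mul_assoc]
      _ = x' * k' * (x'⁻¹ : Rˣ) := by rw [← hkv, hkd', hc]; simp [mul_assoc]
      _ = _ := by rw [hkv']; simp [mul_assoc]
  refine ⟨h', hh, m1, m4⁻¹, hm1, isLeftMin_inv.2 hm4, ?_⟩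
  have hck : (k : R) * c = c * k' := by rw [hkd']; simp [mul_assoc]
  calc (x : R) * e * y * (x' * f * y') = x * (e * q) * c * y' := by
        rw [hqd, hc]; simp [mul_assoc]
    _ = x * (k * k) * c * y' := by rw [show k * k = k from hk]
    _ = x * k * (k * c) * y' := by simp only [mul_assoc]
    _ = (x * k * y) * (x' * k' * y') := by rw [hck, hc]; simp [mul_assoc]
    _ = (((x * v : Rˣ) : R) * h') * (h' * ((y⁻¹ * v)⁻¹ : Rˣ)) *
        ((((x' * v' : Rˣ) : R) * h') * (h' * ((y'⁻¹ * v')⁻¹ : Rˣ))) := by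
        rw [hkv, hkv']
        have hhx : ∀ z, h' * (h' * z) = h' * z := fun z => by rw [← mul_assoc, hhh]
        simp [mul_assoc, hhx]
    _ = (m1 * h') * (h' * (m2⁻¹ : Rˣ)) * ((m3 * h') * (h' * (m4⁻¹ : Rˣ))) := by
        rw [e1, e2', e3, e4']
    _ = m1 * h' * (m4⁻¹ : Rˣ) := by
        have hhx : ∀ z, h' * (h' * z) = h' * z := fun z => by rw [← mul_assoc, hhh]
        rw [hm23]
        simp [mul_assoc, hhx]

/-- One may replace `y` by `d`, shortest modulo both `W_λ(e)` and `W_λ(f)`. The meet `e q`, `q = d f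
d⁻¹`, is conjugate to an element of `Λ` by some `w` centralizing `e`; double coset minimality allows
`w` to be corrected until it also centralizes `q`, hence fixes the meet. -/
theorem mul_conj_mem {e f : R} (he : e ∈ Λ) (hf : f ∈ Λ) {y : Rˣ}
    (hy : IsLeftMin cs (typeMap cs e) y) : e * (y * f * (y⁻¹ : Rˣ)) ∈ Λ := by
  have hF := hR.factorizable
  obtain ⟨d, hd, v, hv, rfl⟩ := exists_mul_minimal (cs := cs) (I := typeMap cs f) y
  have hdI : IsLeftMin cs (typeMap cs e) d := hy.of_mul (hd v hv)
  have hdv : ((d * v : Rˣ) : R) * f * ((d * v)⁻¹ : Rˣ) = d * f * (d⁻¹ : Rˣ) := by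
    rw [eq_comm, conj_eq_conj_iff, inv_mul_cancel_left]
    exact (hR.mem_centralizer_iff hf).1 hv
  rw [hdv]
  obtain ⟨hk, hke, hk', hkf⟩ := hF.idemLE_mul_conj (hR.idem e he) (hR.idem f hf) d
  set q := (d : R) * f * (d⁻¹ : Rˣ) with hqd
  obtain ⟨w, h, hh, g, hg, -, h1, h2⟩ := hR.exists_conj _ e hk (hR.idem e he) hke
  have := hR.eq_of_conj he hg h2
  subst this
  obtain ⟨u, h', hh', g, hg, -, h3, h4⟩ := hR.exists_conj _ f hk' (hR.idem f hf) hkf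
  have := hR.eq_of_conj hf hg h4
  subst this
  have hkk' : e * q = d * (((d⁻¹ : Rˣ) : R) * (e * q) * d) * (d⁻¹ : Rˣ) := by simp [mul_assoc]
  have h3' : ((d⁻¹ : Rˣ) : R) * (e * q) * d = (u⁻¹ : Rˣ) * h' * u := by
    rw [← h3]; simp [mul_assoc]
  rw [h3'] at hkk'
  have h5 : ((w * d * u⁻¹ : Rˣ) : R) * h' * ((w * d * u⁻¹)⁻¹ : Rˣ) = h := by
    rw [← h1, hkk']; simp [mul_assoc]
  have := hR.eq_of_conj hh' hh h5
  subst this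
  have hw := (hR.mem_centralizer_iff he).2 (conj_eq_iff_commute.1 h2)
  have hu := (hR.mem_centralizer_iff hf).2 (conj_eq_iff_commute.1 h4)
  have hwdu := (hR.mem_centralizer_iff hh).2 (conj_eq_iff_commute.1 h5)
  -- The element `w d u⁻¹` centralizes the representative in `Λ`, so it can be rewritten as `p d r`
  -- with `p` centralizing both that representative and `e`. The correction is `p⁻¹ w`, which
  -- satisfies `p⁻¹ w d = d (r u)`.
  obtain ⟨p, r, hpe, hph, hrf, -, hpr⟩ :=
    exists_factor_in_parabolic hdI hd hw (inv_mem hu) hwdu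
  have hwd : (p⁻¹ * w) * d = d * (r * u) := by
    calc (p⁻¹ * w) * d = p⁻¹ * (w * d * u⁻¹) * u := by group
      _ = d * (r * u) := by rw [hpr]; group
  have hpw := Subgroup.mul_mem _ (inv_mem hpe) hw
  have hru := Subgroup.mul_mem _ hrf hu
  suffices h' = e * q by rw [← this]; exact hh
  have hpe' : ((p⁻¹ : Rˣ) : R) * h' * (p⁻¹⁻¹ : Rˣ) = h' :=
    conj_eq_iff_commute.2 ((hR.mem_centralizer_iff hh).1 (inv_mem hph))
  have hpwe : ((p⁻¹ * w : Rˣ) : R) * e * ((p⁻¹ * w)⁻¹ : Rˣ) = e :=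
    conj_eq_iff_commute.2 ((hR.mem_centralizer_iff he).1 hpw)
  have hruf : ((r * u : Rˣ) : R) * f * ((r * u)⁻¹ : Rˣ) = f :=
    conj_eq_iff_commute.2 ((hR.mem_centralizer_iff hf).1 hru)
  calc h' = ((p⁻¹ * w : Rˣ) : R) * (e * q) * ((p⁻¹ * w)⁻¹ : Rˣ) := by
        nth_rewrite 1 [← hpe', ← h1]; simp [mul_assoc]
    _ = (((p⁻¹ * w : Rˣ) : R) * e * ((p⁻¹ * w)⁻¹ : Rˣ)) *
        (((p⁻¹ * w * d : Rˣ) : R) * f * ((p⁻¹ * w * d)⁻¹ : Rˣ)) := by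
        rw [hqd]; simp [mul_assoc]
    _ = e * (((d * (r * u) : Rˣ) : R) * f * ((d * (r * u))⁻¹ : Rˣ)) := by rw [hpwe, hwd]
    _ = e * (d * (((r * u : Rˣ) : R) * f * ((r * u)⁻¹ : Rˣ)) * (d⁻¹ : Rˣ)) := by
        simp [mul_assoc]
    _ = e * q := by rw [hruf]

/-- The product is some `x h y2` in `O` whose range idempotent lies in `Λ`; hence `x` centralizes
`h`, and being shortest it is `1`. -/
theorem gaussJordan_mul {r s : R} (hr : r ∈ gaussJordan cs Λ) (hs : s ∈ gaussJordan cs Λ) :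
    r * s ∈ gaussJordan cs Λ := by
  have hF := hR.factorizable
  obtain ⟨h, hh, x, y2, hx, hy2, hrs⟩ :=
    hR.orderPreserving_mul (gaussJordan_subset hr) (gaussJordan_subset hs)
  obtain ⟨e, he, y, hy, rfl⟩ := hr
  obtain ⟨f, hf, z, hz, rfl⟩ := hs
  have hg := hR.mul_conj_mem he hf hy
  have e1 : e * (y : R) * (f * z) =
      (1 : Rˣ) * (e * (y * f * (y⁻¹ : Rˣ))) * (y * z : Rˣ) := by simp [mul_assoc]
  have e2 := hF.conj_eq_of_mul_eq_mul (hR.idem _ hh) (hR.idem _ hg) (hrs.symm.trans e1)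
  have e3 := hR.eq_of_conj_eq_conj hh hg e2
  rw [← e3, conj_eq_conj_iff, ← hR.mem_centralizer_iff hh, mul_one] at e2
  have : x = 1 := hx.eq_one_of_mem (inv_mem_iff.1 e2)
  subst this
  exact ⟨h, hh, y2, hy2, by simpa using hrs⟩

theorem one_mem_gaussJordan : (1 : R) ∈ gaussJordan cs Λ :=
  ⟨1, hR.one_mem, 1, isLeftMin_one _, by simp⟩

end IsRennerCoxeterSystem

namespace IsRennerCoxeterSystem

variable {R : Type u} [Monoid R] {B : Type v} {M : CoxeterMatrix B} {cs : CoxeterSystem M Rˣ}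
  {Λ : Set R} (hR : IsRennerCoxeterSystem cs Λ)
include hR

/-! ### Elementary properties of the Adherence orders -/

theorem adhPos_of_bruhatLE {e r s : R} {x y a b : Rˣ} (hr : IsLeftStandard cs Λ x e y r)
    (hs : IsLeftStandard cs Λ a e b s) (h : bruhatLE cs x a) (h' : bruhatLE cs b y) :
    adhPos cs Λ r s := by
  have he := hR.mul_self hr.2.1
  refine ⟨x, e, y, a, e, b, hr, hs, ⟨he, he⟩, 1, ?_, by simpa using h, by simpa using h'⟩
  exact Set.mem_mul.2 ⟨1, Subgroup.one_mem _, 1, Subgroup.one_mem _, mul_one 1⟩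

omit hR in
theorem upperLower_subset {e : R} {w : Rˣ}
    (h : w ∈ (parabolic cs (upperType cs e) : Set Rˣ) * (parabolic cs (lowerType cs e) : Set Rˣ)) :
    w ∈ parabolic cs (typeMap cs e) := by
  obtain ⟨a, ha, b, hb, rfl⟩ := Set.mem_mul.1 h
  exact Subgroup.mul_mem _ (parabolic_mono cs (upperType_subset e) ha)
    (parabolic_mono cs (lowerType_subset e) hb)

/-- Lengths give `ℓ(w) + ℓ(b) ≤ ℓ(y)` and `ℓ(w') + ℓ(y) ≤ ℓ(b)`, so both witnesses are trivial and
the Bruhat comparisons are between elements of equal length. -/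
theorem adhPos_antisymm {r s : R} (h : adhPos cs Λ r s) (h' : adhPos cs Λ s r) : r = s := by
  obtain ⟨x, e, y, a, f, b, hr, hs, hle, w, hw, h1, h2⟩ := h
  obtain ⟨a', f', b', x', e', y', hs', hr', hle', w', hw', h3, h4⟩ := h'
  obtain ⟨rfl, rfl, rfl⟩ := hR.leftStandard_unique hr hr'
  obtain ⟨rfl, rfl, rfl⟩ := hR.leftStandard_unique hs hs'
  have := eq_of_idemLE hle hle'
  subst this
  have hwt := upperLower_subset hw
  have hwt' := upperLower_subset hw'
  have hy := (isLeftStandard_iff.1 hr).2.2.2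
  have hb := (isLeftStandard_iff.1 hs).2.2.2
  have l2 := bruhatLE_length_le h2
  have l4 := bruhatLE_length_le h4
  rw [hb _ (inv_mem hwt), cs.length_inv] at l2
  rw [hy _ (inv_mem hwt'), cs.length_inv] at l4
  have e1 : w = 1 := by rw [← cs.length_eq_zero_iff]; omega
  have e2 : w' = 1 := by rw [← cs.length_eq_zero_iff]; omega
  subst e1 e2
  simp only [inv_one, one_mul, mul_one] at h1 h2 h3 h4
  have := bruhatLE_eq_of_length_le h1 (bruhatLE_length_le h3)
  subst this
  have := bruhatLE_eq_of_length_le h2 (bruhatLE_length_le h4)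
  subst this
  rw [hr.1, hs.1]

theorem isRightStandard_iff_starInv {x y : Rˣ} {e r : R} :
    IsRightStandard cs Λ y e x r ↔ IsLeftStandard cs Λ x⁻¹ e y⁻¹ (starInv r) := by
  have hF := hR.factorizable
  rw [isLeftStandard_iff, isRightStandard_iff, isLeftMin_inv, isRightMin_inv]
  constructor
  · rintro ⟨rfl, he, hy, hx⟩
    exact ⟨hF.starInv_form (hR.idem e he) y x, he, hx, hy⟩
  · rintro ⟨h, he, hx, hy⟩
    refine ⟨?_, he, hy, hx⟩
    rw [← hF.starInv_starInv r, h, hF.starInv_form (hR.idem e he), inv_inv, inv_inv]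

theorem adhNeg_iff {r s : R} : adhNeg cs Λ r s ↔ adhPos cs Λ (starInv r) (starInv s) := by
  constructor
  · rintro ⟨y, e, x, b, f, a, hr, hs, hle, w, hw, h1, h2⟩
    refine ⟨x⁻¹, e, y⁻¹, a⁻¹, f, b⁻¹, hR.isRightStandard_iff_starInv.1 hr,
      hR.isRightStandard_iff_starInv.1 hs, hle, w⁻¹, ?_, ?_, ?_⟩
    · obtain ⟨p, hp, q, hq, rfl⟩ := Set.mem_mul.1 hw
      rw [mul_inv_rev]
      exact Set.mem_mul.2 ⟨q⁻¹, inv_mem hq, p⁻¹, inv_mem hp, rfl⟩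
    · rw [← mul_inv_rev, bruhatLE_inv_iff]; exact h1
    · rw [← mul_inv_rev, bruhatLE_inv_iff]; exact h2
  · rintro ⟨x, e, y, a, f, b, hr, hs, hle, w, hw, h1, h2⟩
    refine ⟨y⁻¹, e, x⁻¹, b⁻¹, f, a⁻¹, ?_, ?_, hle, w⁻¹, ?_, ?_, ?_⟩
    · rw [hR.isRightStandard_iff_starInv, inv_inv, inv_inv]; exact hr
    · rw [hR.isRightStandard_iff_starInv, inv_inv, inv_inv]; exact hs
    · obtain ⟨p, hp, q, hq, rfl⟩ := Set.mem_mul.1 hw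
      rw [mul_inv_rev]
      exact Set.mem_mul.2 ⟨q⁻¹, inv_mem hq, p⁻¹, inv_mem hp, rfl⟩
    · rw [← mul_inv_rev, bruhatLE_inv_iff]; exact h1
    · rw [← mul_inv_rev, bruhatLE_inv_iff]; exact h2

theorem adh_antisymm {ε : Sgn} {r s : R} (h : adh cs Λ ε r s) (h' : adh cs Λ ε s r) : r = s := by
  cases ε with
  | pos => exact hR.adhPos_antisymm h h'
  | neg =>
    have := hR.adhPos_antisymm (hR.adhNeg_iff.1 h) (hR.adhNeg_iff.1 h')
    rw [← hR.factorizable.starInv_starInv r, this, hR.factorizable.starInv_starInv]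

/-- By antisymmetry a class has at most one least element, so a supply of least elements meeting
every class is complete. -/
theorem minSet_eq {ε : Sgn} {T : Setoid R} {C : Set R} (hex : ∀ r, ∃ c ∈ C, T r c)
    (hmin : ∀ c ∈ C, ∀ t, T c t → adh cs Λ ε c t) : minSet cs Λ ε T = C := by
  ext r
  constructor
  · intro h
    obtain ⟨c, hc, hrc⟩ := hex r
    rw [hR.adh_antisymm (h c hrc) (hmin c hc r (T.symm hrc))]
    exact hc
  · exact hmin r

theorem maxSet_eq {ε : Sgn} {T : Setoid R} {C : Set R} (hex : ∀ r, ∃ c ∈ C, T r c)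
    (hmax : ∀ c ∈ C, ∀ t, T c t → adh cs Λ ε t c) : maxSet cs Λ ε T = C := by
  ext r
  constructor
  · intro h
    obtain ⟨c, hc, hrc⟩ := hex r
    rw [hR.adh_antisymm (hmax c hc r (T.symm hrc)) (h c hrc)]
    exact hc
  · exact hmax r

theorem minSet_neg {T T' : Setoid R} (h : ∀ r t, T r t ↔ T' (starInv r) (starInv t)) :
    minSet cs Λ .neg T = {r | starInv r ∈ minSet cs Λ .pos T'} := by
  have hF := hR.factorizable
  ext r
  constructor
  · intro hr t ht
    have h1 := hR.adhNeg_iff.1 (hr (starInv t) ((h _ _).2 (by rwa [hF.starInv_starInv])))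
    rwa [hF.starInv_starInv] at h1
  · intro hr t ht
    exact hR.adhNeg_iff.2 (hr _ ((h _ _).1 ht))

theorem maxSet_neg {T T' : Setoid R} (h : ∀ r t, T r t ↔ T' (starInv r) (starInv t)) :
    maxSet cs Λ .neg T = {r | starInv r ∈ maxSet cs Λ .pos T'} := by
  have hF := hR.factorizable
  ext r
  constructor
  · intro hr t ht
    have h1 := hR.adhNeg_iff.1 (hr (starInv t) ((h _ _).2 (by rwa [hF.starInv_starInv])))
    rwa [hF.starInv_starInv] at h1
  · intro hr t ht
    exact hR.adhNeg_iff.2 (hr _ ((h _ _).1 ht))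

theorem exists_minSet_neg {T T' : Setoid R} (h : ∀ r t, T r t ↔ T' (starInv r) (starInv t))
    (hex : ∀ r, ∃ c ∈ minSet cs Λ .pos T', T' r c) (r : R) :
    ∃ c ∈ minSet cs Λ .neg T, T r c := by
  have hF := hR.factorizable
  obtain ⟨c, hc, hrc⟩ := hex (starInv r)
  refine ⟨starInv c, ?_, ?_⟩
  · rw [hR.minSet_neg h, Set.mem_ofPred_eq, hF.starInv_starInv]
    exact hc
  · rw [h, hF.starInv_starInv]
    exact hrc

theorem bijOn_minSet {ε : Sgn} {T : Setoid R} (hex : ∀ r, ∃ c ∈ minSet cs Λ ε T, T r c) :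
    Set.BijOn (fun r => (Quotient.mk T r)) (minSet cs Λ ε T) Set.univ := by
  refine ⟨fun _ _ => Set.mem_univ _, ?_, ?_⟩
  · intro r hr s hs h
    have h' : T r s := Quotient.exact h
    exact hR.adh_antisymm (hr s h') (hs r (T.symm h'))
  · intro q _
    induction q using Quotient.inductionOn with
    | h r =>
      obtain ⟨c, hc, hrc⟩ := hex r
      exact ⟨c, hc, Quotient.sound (T.symm hrc)⟩

/-! ### Minimum elements for the order `≤⁺` -/

omit hR in
theorem isLeftMin_longest_mul {w₀ : Rˣ} (hw : IsLongestIn cs Set.univ w₀) {I : Set B} {z : Rˣ}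
    (hz : IsLongestIn cs I z) : IsLeftMin cs I (z * w₀) := by
  have h := hw.isRightMin_mul (Set.subset_univ I) hz
  rwa [← isLeftMin_inv, mul_inv_rev, hz.inv_eq, hw.inv_eq] at h

-- Thus `z w₀` is the Bruhat-greatest shortest representative; as `≤⁺` reverses the right factor, it
-- is the right factor of minima.
omit hR in
theorem bruhatLE_longest_mul_of_isLeftMin {w₀ : Rˣ} (hw : IsLongestIn cs Set.univ w₀)
    {I : Set B} {z y : Rˣ} (hz : IsLongestIn cs I z) (hy : IsLeftMin cs I y) :
    bruhatLE cs y (z * w₀) := by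
  have h := bruhatLE_longest_mul (Set.subset_univ I) hw hz (isRightMin_one _) (u := y⁻¹)
    (parabolic_univ (cs := cs) ▸ Subgroup.mem_top _) (by rwa [one_mul, isRightMin_inv])
  rw [← bruhatLE_inv_iff]
  simpa [hz.inv_eq, hw.inv_eq] using h

theorem exists_gaussJordan (r : R) : ∃ c ∈ gaussJordan cs Λ, greenL R r c := by
  obtain ⟨e, he, u, v, rfl⟩ := hR.exists_form r
  obtain ⟨p, hp, y, hs⟩ := hR.exists_leftStandard he u v
  have h := isLeftStandard_iff.1 hs
  refine ⟨e * y, ⟨e, he, y, h.2.2.2, rfl⟩, ?_⟩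
  rw [hR.factorizable.greenL_iff]
  exact ⟨(u * p)⁻¹, by rw [h.1]; simp [mul_assoc]⟩

/-- Elements of the `𝓛`-class of `e y` in left standard form. -/
theorem exists_leftStandard_of_greenL {e t : R} {u y : Rˣ} (he : e ∈ Λ)
    (hy : IsLeftMin cs (typeMap cs e) y) (h : greenL R ((u : R) * e * y) t) :
    ∃ m, IsLeftStandard cs Λ m e y t := by
  obtain ⟨w, rfl⟩ := hR.factorizable.greenL_iff.1 h
  obtain ⟨m, hm, d, hd, hwm⟩ := exists_mul_minimal (cs := cs) (I := lowerType cs e) (w * u)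
  refine ⟨m, isLeftStandard_iff.2 ⟨?_, he, hm, hy⟩⟩
  rw [← hR.mul_eq_mul_of_mem_stabilizer he m hd, ← hwm]
  simp [mul_assoc]

omit hR in
theorem isLeftStandard_one {e : R} {y : Rˣ} (he : e ∈ Λ) (hy : IsLeftMin cs (typeMap cs e) y) :
    IsLeftStandard cs Λ 1 e y (e * y) :=
  isLeftStandard_iff.2 ⟨by simp, he, isRightMin_one _, hy⟩

/-- An 𝓛-class fixes `e` and `y`, so the least left factor is `1`. -/
theorem minSet_greenL : minSet cs Λ .pos (greenL R) = gaussJordan cs Λ := by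
  refine hR.minSet_eq hR.exists_gaussJordan ?_
  rintro _ ⟨e, he, y, hy, rfl⟩ t ht
  obtain ⟨m, hm⟩ := hR.exists_leftStandard_of_greenL (u := 1) he hy (by simpa using ht)
  exact hR.adhPos_of_bruhatLE (isLeftStandard_one he hy) hm (one_bruhatLE _) (bruhatLE_refl _)

/-- Elements of the `𝓗`-class of `x e y` in left standard form. -/
theorem exists_leftStandard_of_greenH {e t : R} {x y : Rˣ} (he : e ∈ Λ)
    (hy : IsLeftMin cs (typeMap cs e) y) (h : greenH R ((x : R) * e * y) t) :
    ∃ p ∈ parabolic cs (typeMap cs e), IsLeftStandard cs Λ (x * p) e y t := by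
  have hF := hR.factorizable
  obtain ⟨m, hm⟩ := hR.exists_leftStandard_of_greenL he hy h.1
  obtain ⟨u, hu⟩ := hF.greenR_iff.1 h.2
  have h1 : (x : R) * e * (y * u : Rˣ) = m * e * y := by
    rw [← (isLeftStandard_iff.1 hm).1, hu]
    simp [mul_assoc]
  have h2 := hF.conj_eq_of_mul_eq_mul (hR.idem e he) (hR.idem e he) h1
  rw [conj_eq_conj_iff, ← hR.mem_centralizer_iff he] at h2
  exact ⟨x⁻¹ * m, h2, by rwa [mul_inv_cancel_left]⟩

theorem exists_orderPreserving (r : R) : ∃ c ∈ orderPreserving cs Λ, greenH R r c := by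
  have hF := hR.factorizable
  obtain ⟨e, he, u, v, rfl⟩ := hR.exists_form r
  obtain ⟨a, ha, y, hy, rfl⟩ := exists_minimal_mul (cs := cs) (I := typeMap cs e) v
  obtain ⟨x, hx, p, hp, h⟩ := exists_mul_minimal (cs := cs) (I := typeMap cs e) (u * a)
  have hr : (u : R) * e * (a * y : Rˣ) = x * p * e * y := by
    rw [hR.mul_eq_mul_of_mem_centralizer he u y ha, h, Units.val_mul]
  have hr' : (u : R) * e * (a * y : Rˣ) = x * e * (p * y : Rˣ) := by
    rw [hr, hR.mul_eq_mul_of_mem_centralizer he x y hp, Units.val_mul]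
  refine ⟨x * e * y, ⟨e, he, x, y, hx, hy, rfl⟩, ?_⟩
  rw [hF.greenH_iff]
  -- The unit `p` between `x` and `y` commutes with `e`, so it can be removed from either side by
  -- conjugation.
  refine ⟨⟨x * p⁻¹ * x⁻¹, ?_⟩, ⟨y⁻¹ * p⁻¹ * y, ?_⟩⟩
  · rw [hr]; simp [mul_assoc]
  · rw [hr']; simp [mul_assoc]

omit hR in
theorem isLeftStandard_of_isRightMin {e : R} {x y : Rˣ} (he : e ∈ Λ)
    (hx : IsRightMin cs (typeMap cs e) x) (hy : IsLeftMin cs (typeMap cs e) y) :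
    IsLeftStandard cs Λ x e y (x * e * y) :=
  isLeftStandard_iff.2 ⟨rfl, he, hx.mono (lowerType_subset e), hy⟩

theorem minSet_greenH : minSet cs Λ .pos (greenH R) = orderPreserving cs Λ := by
  refine hR.minSet_eq hR.exists_orderPreserving ?_
  rintro _ ⟨e, he, x, y, hx, hy, rfl⟩ t ht
  obtain ⟨p, hp, hm⟩ := hR.exists_leftStandard_of_greenH he hy ht
  exact hR.adhPos_of_bruhatLE (isLeftStandard_of_isRightMin he hx hy) hm
    (bruhatLE_mul_right (hx p hp)) (bruhatLE_refl _)

variable {w₀ : Rˣ} (hw : IsLongestIn cs Set.univ w₀)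
include hw

omit hR hw in
variable (cs Λ w₀) in
/-- The elements `x e w_{λ(e)} w₀` with `e ∈ Λ` and `x` shortest in `x W_{λ(e)}`. -/
def jordanGauss : Set R :=
  {r | ∃ e ∈ Λ, ∃ x z : Rˣ, IsRightMin cs (typeMap cs e) x ∧ IsLongestIn cs (typeMap cs e) z ∧
    r = x * e * (z * w₀ : Rˣ)}

omit hw in
theorem exists_jordanGauss [Finite Rˣ] (r : R) :
    ∃ c ∈ jordanGauss cs Λ w₀, greenR R r c := by
  obtain ⟨e, he, u, v, rfl⟩ := hR.exists_form r
  obtain ⟨z, hz⟩ := exists_isLongestIn cs (typeMap cs e)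
  obtain ⟨x, hx, p, hp, rfl⟩ := exists_mul_minimal (cs := cs) (I := typeMap cs e) u
  refine ⟨_, ⟨e, he, x, z, hx, hz, rfl⟩, ?_⟩
  rw [hR.factorizable.greenR_iff]
  refine ⟨(p * v)⁻¹ * (z * w₀), ?_⟩
  rw [← hR.mul_eq_mul_of_mem_centralizer he x v hp]
  simp [mul_assoc]

/-- An 𝓡-class fixes `e` and the coset `x W_λ(e)`: the left factor is least at `x`, and every right
factor lies below `z w₀`. -/
theorem minSet_greenR [Finite Rˣ] : minSet cs Λ .pos (greenR R) = jordanGauss cs Λ w₀ := by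
  refine hR.minSet_eq (hR.exists_jordanGauss) ?_
  rintro _ ⟨e, he, x, z, hx, hz, rfl⟩ t ht
  obtain ⟨u, rfl⟩ := hR.factorizable.greenR_iff.1 ht
  obtain ⟨p, hp, y, hs⟩ := hR.exists_leftStandard he x (z * w₀ * u)
  rw [Units.val_mul (z * w₀), ← mul_assoc] at hs
  exact hR.adhPos_of_bruhatLE
    (isLeftStandard_of_isRightMin he hx (isLeftMin_longest_mul hw hz)) hs
    (bruhatLE_mul_right (hx p hp))
    (bruhatLE_longest_mul_of_isLeftMin hw hz (isLeftStandard_iff.1 hs).2.2.2)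

theorem mem_inter_iff [Finite Rˣ] {r : R} : r ∈ gaussJordan cs Λ ∩ jordanGauss cs Λ w₀ ↔
    ∃ e ∈ Λ, ∃ z, IsLongestIn cs (typeMap cs e) z ∧ r = e * (z * w₀ : Rˣ) := by
  constructor
  · rintro ⟨⟨e, he, y, hy, rfl⟩, ⟨f, hf, x, z, hx, hz, h⟩⟩
    have h1 := isLeftStandard_one he hy
    have h2 := isLeftStandard_of_isRightMin hf hx (isLeftMin_longest_mul hw hz)
    rw [← h] at h2
    obtain ⟨-, rfl, rfl⟩ := hR.leftStandard_unique h1 h2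
    exact ⟨e, he, z, hz, rfl⟩
  · rintro ⟨e, he, z, hz, rfl⟩
    exact ⟨⟨e, he, _, isLeftMin_longest_mul hw hz, rfl⟩,
      ⟨e, he, 1, z, isRightMin_one _, hz, by simp⟩⟩

theorem exists_inter [Finite Rˣ] (r : R) :
    ∃ c ∈ gaussJordan cs Λ ∩ jordanGauss cs Λ w₀, greenJ R r c := by
  obtain ⟨e, he, u, v, rfl⟩ := hR.exists_form r
  obtain ⟨z, hz⟩ := exists_isLongestIn cs (typeMap cs e)
  refine ⟨_, (hR.mem_inter_iff hw).2 ⟨e, he, z, hz, rfl⟩, ?_⟩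
  rw [hR.greenJ_iff]
  exact ⟨u⁻¹, v⁻¹ * (z * w₀), by simp [mul_assoc]⟩

omit hw in
/-- Elements of the `𝓙`-class of `e ∈ Λ` in left standard form. -/
theorem exists_leftStandard_of_greenJ {e t : R} {u v : Rˣ} (he : e ∈ Λ)
    (h : greenJ R ((u : R) * e * v) t) : ∃ m y, IsLeftStandard cs Λ m e y t := by
  obtain ⟨a, b, rfl⟩ := hR.greenJ_iff.1 h
  obtain ⟨p, -, y, hs⟩ := hR.exists_leftStandard he (a * u) (v * b)
  have e1 : (a : R) * (u * e * v) * b = (a * u : Rˣ) * e * (v * b : Rˣ) := by simp [mul_assoc]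
  exact ⟨_, y, e1 ▸ hs⟩

theorem minSet_greenJ [Finite Rˣ] :
    minSet cs Λ .pos (greenJ R) = gaussJordan cs Λ ∩ jordanGauss cs Λ w₀ := by
  refine hR.minSet_eq (hR.exists_inter hw) ?_
  intro c hc t ht
  obtain ⟨e, he, z, hz, rfl⟩ := (hR.mem_inter_iff hw).1 hc
  obtain ⟨m, y, hs⟩ := hR.exists_leftStandard_of_greenJ (u := 1) (v := z * w₀) he
    (by simpa using ht)
  exact hR.adhPos_of_bruhatLE (isLeftStandard_one he (isLeftMin_longest_mul hw hz)) hs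
    (one_bruhatLE _)
    (bruhatLE_longest_mul_of_isLeftMin hw hz (isLeftStandard_iff.1 hs).2.2.2)

/-! ### Conjugation by the longest element -/

omit hR in
theorem longest_mul_self : (w₀ : R) * w₀ = 1 := by
  rw [← Units.val_mul, hw.mul_self, Units.val_one]

omit hR in
theorem longest_mul_cancel (r : R) : (w₀ : R) * (w₀ * r) = r := by
  rw [← mul_assoc, longest_mul_self hw, one_mul]

omit hR in
theorem longest_conj_conj (r : R) : (w₀ : R) * (w₀ * r * w₀) * w₀ = r := by
  simp [mul_assoc, longest_mul_self hw, longest_mul_cancel hw]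

omit hR in
theorem longest_conj_mul (r s : R) :
    (w₀ : R) * (r * s) * w₀ = (w₀ * r * w₀) * (w₀ * s * w₀) := by
  simp [mul_assoc, longest_mul_cancel hw]

theorem starInv_longest_conj (r : R) :
    starInv ((w₀ : R) * r * w₀) = w₀ * starInv r * w₀ := by
  have hF := hR.factorizable
  rw [hF.starInv_mul, hF.starInv_mul, hF.starInv_unit, hw.inv_eq, mul_assoc]

omit hR in
theorem isRightMin_longest_conj {I : Set B} {x z : Rˣ} (hz : IsLongestIn cs I z)
    (hx : IsRightMin cs I x) : IsRightMin cs I (w₀ * x * z) :=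
  hw.isRightMin_conj parabolic_univ hz hx

omit hR in
theorem isLeftMin_longest_conj {I : Set B} {y z : Rˣ} (hz : IsLongestIn cs I z)
    (hy : IsLeftMin cs I y) : IsLeftMin cs I (z * y * w₀) := by
  have := isRightMin_longest_conj hw hz (isRightMin_inv.2 hy)
  rw [← isLeftMin_inv, mul_inv_rev, mul_inv_rev, hw.inv_eq, hz.inv_eq, inv_inv, ← mul_assoc] at this
  exact this

omit hw in
theorem mul_longest_eq {e : R} (he : e ∈ Λ) {z : Rˣ} (hz : IsLongestIn cs (typeMap cs e) z)
    (x y : Rˣ) : (x : R) * e * y = (x * z : Rˣ) * e * (z * y : Rˣ) := by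
  rw [← hR.mul_eq_mul_of_mem_centralizer he x (z * y) hz.1, ← mul_assoc, hz.mul_self, one_mul]

/-- Inserting `z z = 1` around `e` gives `w₀ x e y w₀ = (w₀ x z) e (z y w₀)`, whose outer factors
are again shortest. -/
theorem longest_conj_mem_orderPreserving [Finite Rˣ] {r : R} (hr : r ∈ orderPreserving cs Λ) :
    (w₀ : R) * r * w₀ ∈ orderPreserving cs Λ := by
  obtain ⟨e, he, x, y, hx, hy, rfl⟩ := hr
  obtain ⟨z, hz⟩ := exists_isLongestIn cs (typeMap cs e)
  refine ⟨e, he, w₀ * x * z, z * y * w₀, isRightMin_longest_conj hw hz hx,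
    isLeftMin_longest_conj hw hz hy, ?_⟩
  rw [hR.mul_longest_eq he hz]
  simp [mul_assoc]

theorem mem_jordanGauss_iff [Finite Rˣ] {r : R} :
    r ∈ jordanGauss cs Λ w₀ ↔ starInv ((w₀ : R) * r * w₀) ∈ gaussJordan cs Λ := by
  have hF := hR.factorizable
  constructor
  · rintro ⟨e, he, x, z, hx, hz, rfl⟩
    have h1 := isRightMin_longest_conj hw hz hx
    refine ⟨e, he, (w₀ * x * z)⁻¹, isLeftMin_inv.2 h1, ?_⟩
    have : (w₀ : R) * (x * e * (z * w₀ : Rˣ)) * w₀ = (w₀ * x * z : Rˣ) * e * (1 : Rˣ) := by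
      rw [hR.mul_longest_eq he hz]
      have hzz : (z : R) * (z * (w₀ * w₀)) = 1 := by
        rw [longest_mul_self hw, mul_one, ← Units.val_mul, hz.mul_self, Units.val_one]
      simp [mul_assoc, hzz]
    rw [this, hF.starInv_form (hR.idem e he)]
    simp
  · rintro ⟨e, he, y, hy, h⟩
    obtain ⟨z, hz⟩ := exists_isLongestIn cs (typeMap cs e)
    refine ⟨e, he, w₀ * y⁻¹ * z, z, isRightMin_longest_conj hw hz (isRightMin_inv.2 hy), hz, ?_⟩
    rw [← longest_conj_conj hw r, ← hF.starInv_starInv (w₀ * r * w₀), h]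
    have : e * (y : R) = (1 : Rˣ) * e * y := by simp
    rw [this, hF.starInv_form (hR.idem e he), hR.mul_longest_eq he hz]
    simp [mul_assoc]

/-! ### Maximum elements for the order `≤⁺` -/

/-- The greatest left factor that is shortest modulo `W_λ_*(e)` is `w₀ k`, with `k` longest in
`W_λ_*(e)`; and `e` absorbs `k`. -/
theorem maxSet_greenL [Finite Rˣ] :
    maxSet cs Λ .pos (greenL R) = leftTranslate w₀ (gaussJordan cs Λ) := by
  have hF := hR.factorizable
  refine hR.maxSet_eq ?_ ?_
  · intro r
    obtain ⟨c, hc, h⟩ := hR.exists_gaussJordan r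
    refine ⟨_, ⟨c, hc, rfl⟩, (greenL R).trans h ?_⟩
    exact hF.greenL_iff.2 ⟨w₀, rfl⟩
  · rintro _ ⟨_, ⟨e, he, y, hy, rfl⟩, rfl⟩ t ht
    obtain ⟨k, hk⟩ := exists_isLongestIn cs (lowerType cs e)
    obtain ⟨m, hm⟩ := hR.exists_leftStandard_of_greenL (u := w₀) he hy
      (by simpa [mul_assoc] using ht)
    have hs : IsLeftStandard cs Λ (w₀ * k) e y (w₀ * (e * y)) :=
      isLeftStandard_iff.2 ⟨by rw [hR.mul_eq_mul_of_mem_stabilizer he w₀ hk.1, mul_assoc], he,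
        hw.isRightMin_mul (Set.subset_univ _) hk, hy⟩
    refine hR.adhPos_of_bruhatLE hm hs ?_ (bruhatLE_refl _)
    simpa using bruhatLE_longest_mul (Set.subset_univ _) hw hk (isRightMin_one _) (u := m)
      (parabolic_univ (cs := cs) ▸ Subgroup.mem_top _)
      (by simpa using (isLeftStandard_iff.1 hm).2.2.1)

theorem maxSet_greenJ [Finite Rˣ] :
    maxSet cs Λ .pos (greenJ R) = leftTranslate w₀ Λ := by
  refine hR.maxSet_eq ?_ ?_
  · intro r
    obtain ⟨e, he, u, v, rfl⟩ := hR.exists_form r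
    refine ⟨_, ⟨e, he, rfl⟩, ?_⟩
    rw [hR.greenJ_iff]
    exact ⟨w₀ * u⁻¹, v⁻¹, by simp [mul_assoc]⟩
  · rintro _ ⟨e, he, rfl⟩ t ht
    obtain ⟨k, hk⟩ := exists_isLongestIn cs (lowerType cs e)
    obtain ⟨m, y, hm⟩ := hR.exists_leftStandard_of_greenJ (u := w₀) (v := 1) he
      (by simpa using ht)
    have hs : IsLeftStandard cs Λ (w₀ * k) e 1 (w₀ * e) :=
      isLeftStandard_iff.2 ⟨by rw [hR.mul_eq_mul_of_mem_stabilizer he w₀ hk.1]; simp, he,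
        hw.isRightMin_mul (Set.subset_univ _) hk, isLeftMin_one _⟩
    refine hR.adhPos_of_bruhatLE hm hs ?_ (one_bruhatLE _)
    simpa using bruhatLE_longest_mul (Set.subset_univ _) hw hk (isRightMin_one _) (u := m)
      (parabolic_univ (cs := cs) ▸ Subgroup.mem_top _)
      (by simpa using (isLeftStandard_iff.1 hm).2.2.1)

omit hw in
theorem isLeftStandard_longest {e : R} {x y z k : Rˣ} (he : e ∈ Λ)
    (hx : IsRightMin cs (typeMap cs e) x) (hy : IsLeftMin cs (typeMap cs e) y)
    (hz : IsLongestIn cs (typeMap cs e) z) (hk : IsLongestIn cs (lowerType cs e) k) :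
    IsLeftStandard cs Λ (x * (z * k)) e y ((x * z : Rˣ) * e * y) := by
  refine isLeftStandard_iff.2 ⟨?_, he, ?_, hy⟩
  · rw [← mul_assoc, hR.mul_eq_mul_of_mem_stabilizer he _ hk.1]
  · exact hx.mul (lowerType_subset e)
      (Subgroup.mul_mem _ hz.1 (parabolic_mono cs (lowerType_subset e) hk.1))
      (hz.isRightMin_mul (lowerType_subset e) hk)

/-- Right translation by `w₀` turns `x e z w₀` into `x z e`. Its right factor `1` is least, and its
left factor `x z k`, with `k` longest in `W_λ_*(e)`, is greatest among those in `x W_λ(e)`. -/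
theorem maxSet_greenR [Finite Rˣ] :
    maxSet cs Λ .pos (greenR R) = rightTranslate (jordanGauss cs Λ w₀) w₀ := by
  have hF := hR.factorizable
  refine hR.maxSet_eq ?_ ?_
  · intro r
    obtain ⟨c, hc, h⟩ := hR.exists_jordanGauss r
    refine ⟨_, ⟨c, hc, rfl⟩, (greenR R).trans h ?_⟩
    exact hF.greenR_iff.2 ⟨w₀, rfl⟩
  · rintro _ ⟨_, ⟨e, he, x, z, hx, hz, rfl⟩, rfl⟩ t ht
    obtain ⟨k, hk⟩ := exists_isLongestIn cs (lowerType cs e)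
    have hc : (x : R) * e * (z * w₀ : Rˣ) * w₀ = (x * z : Rˣ) * e * (1 : Rˣ) := by
      rw [← hR.mul_eq_mul_of_mem_centralizer he x 1 hz.1]
      simp [mul_assoc, longest_mul_self hw]
    simp only [hc] at ht ⊢
    obtain ⟨u, rfl⟩ := hF.greenR_iff.1 ht
    obtain ⟨p, hp, y, hs⟩ := hR.exists_leftStandard he (x * z) u
    rw [mul_assoc x] at hs
    have hzp := Subgroup.mul_mem _ hz.1 hp
    have := hR.isLeftStandard_longest he hx (isLeftMin_one _) hz hk
    refine hR.adhPos_of_bruhatLE (by simpa using hs) this ?_ (one_bruhatLE _)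
    exact bruhatLE_longest_mul (lowerType_subset e) hz hk hx hzp (isLeftStandard_iff.1 hs).2.2.1

theorem maxSet_greenH [Finite Rˣ] :
    maxSet cs Λ .pos (greenH R) = rightTranslate (orderPreserving cs Λ) w₀ := by
  have hF := hR.factorizable
  refine hR.maxSet_eq ?_ ?_
  · intro r
    obtain ⟨c, ⟨e, he, x, y, hx, hy, rfl⟩, h⟩ := hR.exists_orderPreserving r
    obtain ⟨z, hz⟩ := exists_isLongestIn cs (typeMap cs e)
    refine ⟨_, ⟨x * e * (z * y * w₀ : Rˣ),
      ⟨e, he, x, _, hx, isLeftMin_longest_conj hw hz hy, rfl⟩, rfl⟩, (greenH R).trans h ?_⟩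
    have h1 : (x : R) * e * (z * y * w₀ : Rˣ) * w₀ = x * e * (z * y : Rˣ) := by
      simp [mul_assoc, longest_mul_self hw]
    simp only [h1]
    refine hF.greenH_iff.2 ⟨⟨x * z * x⁻¹, ?_⟩, ⟨y⁻¹ * z * y, by simp [mul_assoc]⟩⟩
    rw [hR.mul_eq_mul_of_mem_centralizer he x y hz.1]
    simp [mul_assoc]
  · rintro _ ⟨_, ⟨e, he, x, y, hx, hy, rfl⟩, rfl⟩ t ht
    obtain ⟨k, hk⟩ := exists_isLongestIn cs (lowerType cs e)
    obtain ⟨z, hz⟩ := exists_isLongestIn cs (typeMap cs e)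
    have hy' := isLeftMin_longest_conj hw hz hy
    -- This makes the right factor shortest again and moves `z` to the left, where it produces the
    -- greatest left factor of the 𝓗-class.
    have hc : (x : R) * e * y * w₀ = (x * z : Rˣ) * e * (z * y * w₀ : Rˣ) := by
      rw [hR.mul_longest_eq he hz]
      simp [mul_assoc]
    simp only [hc] at ht ⊢
    obtain ⟨p, hp, hs⟩ := hR.exists_leftStandard_of_greenH he hy' ht
    rw [mul_assoc x] at hs
    have hzp := Subgroup.mul_mem _ hz.1 hp
    refine hR.adhPos_of_bruhatLE hs (hR.isLeftStandard_longest he hx hy' hz hk) ?_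
      (bruhatLE_refl _)
    exact bruhatLE_longest_mul (lowerType_subset e) hz hk hx hzp (isLeftStandard_iff.1 hs).2.2.1

end IsRennerCoxeterSystem

namespace IsRennerCoxeterSystem

variable {R : Type u} [Monoid R] {B : Type v} {M : CoxeterMatrix B} {cs : CoxeterSystem M Rˣ}
  {Λ : Set R} (hR : IsRennerCoxeterSystem cs Λ) {w₀ : Rˣ} (hw : IsLongestIn cs Set.univ w₀)
include hR hw

/-! ### The four monoids for both signs -/

section

variable [Finite Rˣ]

omit hw [Finite Rˣ] in
theorem GJ_pos : GJ cs Λ .pos = gaussJordan cs Λ := hR.minSet_greenL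

theorem JG_pos : JG cs Λ .pos = {r | starInv ((w₀ : R) * r * w₀) ∈ gaussJordan cs Λ} := by
  ext r
  rw [JG, hR.minSet_greenR hw, hR.mem_jordanGauss_iff hw]
  rfl

/-- Inversion leads from `GJ⁻` to `JG⁺`, which is related to `GJ⁺` by inversion and
`w₀`-conjugation; the two inversions cancel. -/
theorem GJ_neg : GJ cs Λ .neg = {r | (w₀ : R) * r * w₀ ∈ gaussJordan cs Λ} := by
  have hF := hR.factorizable
  rw [GJ, hR.minSet_neg fun r t => hF.greenL_iff_greenR_starInv]
  ext r
  change starInv r ∈ JG cs Λ .pos ↔ _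
  rw [hR.JG_pos hw, Set.mem_ofPred_eq, hR.starInv_longest_conj hw, hF.starInv_starInv]
  rfl

omit hw [Finite Rˣ] in
theorem JG_neg : JG cs Λ .neg = {r | starInv r ∈ gaussJordan cs Λ} := by
  rw [JG, hR.minSet_neg fun r t => hR.factorizable.greenR_iff_greenL_starInv, hR.minSet_greenL]

theorem NU_eq (ε : Sgn) : NU cs Λ ε = GJ cs Λ ε ∩ JG cs Λ ε := by
  have hF := hR.factorizable
  cases ε with
  | pos =>
    rw [NU, GJ, JG, hR.minSet_greenJ hw, hR.minSet_greenL, hR.minSet_greenR hw]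
  | neg =>
    rw [NU, GJ, JG, hR.minSet_neg fun r t => hR.greenJ_iff_starInv,
      hR.minSet_neg fun r t => hF.greenL_iff_greenR_starInv,
      hR.minSet_neg fun r t => hF.greenR_iff_greenL_starInv, hR.minSet_greenJ hw,
      hR.minSet_greenL, hR.minSet_greenR hw, Set.inter_comm]
    rfl

omit hw [Finite Rˣ] in
theorem starInv_mem_orderPreserving {r : R} (hr : r ∈ orderPreserving cs Λ) :
    starInv r ∈ orderPreserving cs Λ := by
  obtain ⟨e, he, x, y, hx, hy, rfl⟩ := hr
  exact ⟨e, he, y⁻¹, x⁻¹, isRightMin_inv.2 hy, isLeftMin_inv.2 hx,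
    hR.factorizable.starInv_form (hR.idem e he) x y⟩

omit hw [Finite Rˣ] in
theorem Oh_eq (ε : Sgn) : Oh cs Λ ε = orderPreserving cs Λ := by
  have hF := hR.factorizable
  cases ε with
  | pos => exact hR.minSet_greenH
  | neg =>
    rw [Oh, hR.minSet_neg fun r t => hF.greenH_iff_starInv, hR.minSet_greenH]
    ext r
    refine ⟨fun h => ?_, hR.starInv_mem_orderPreserving⟩
    rw [← hF.starInv_starInv r]
    exact hR.starInv_mem_orderPreserving h

theorem mem_GJ_iff (ε : Sgn) {r : R} : r ∈ GJ cs Λ ε ↔ starInv r ∈ JG cs Λ ε.opp := by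
  have hF := hR.factorizable
  cases ε with
  | pos =>
    rw [Sgn.opp, hR.GJ_pos, hR.JG_neg, Set.mem_ofPred_eq, hF.starInv_starInv]
  | neg =>
    rw [Sgn.opp, hR.GJ_neg hw, hR.JG_pos hw, Set.mem_ofPred_eq, Set.mem_ofPred_eq,
      hR.starInv_longest_conj hw, hF.starInv_starInv]

omit hR hw [Finite Rˣ] in
theorem opp_opp (ε : Sgn) : ε.opp.opp = ε := by cases ε <;> rfl

theorem mem_JG_iff (ε : Sgn) {r : R} : r ∈ JG cs Λ ε ↔ starInv r ∈ GJ cs Λ ε.opp := by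
  rw [hR.mem_GJ_iff hw, opp_opp, hR.factorizable.starInv_starInv]

theorem GJ_subset (ε : Sgn) : GJ cs Λ ε ⊆ orderPreserving cs Λ := by
  cases ε with
  | pos =>
    rw [hR.GJ_pos]
    exact gaussJordan_subset
  | neg =>
    rw [hR.GJ_neg hw]
    intro r hr
    rw [← longest_conj_conj hw r]
    exact hR.longest_conj_mem_orderPreserving hw (gaussJordan_subset hr)

theorem JG_subset (ε : Sgn) : JG cs Λ ε ⊆ orderPreserving cs Λ := by
  intro r hr
  rw [← hR.factorizable.starInv_starInv r]
  exact hR.starInv_mem_orderPreserving (hR.GJ_subset hw _ ((hR.mem_JG_iff hw ε).1 hr))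

theorem one_mem_GJ (ε : Sgn) : (1 : R) ∈ GJ cs Λ ε := by
  cases ε with
  | pos => rw [hR.GJ_pos]; exact hR.one_mem_gaussJordan
  | neg =>
    rw [hR.GJ_neg hw, Set.mem_ofPred_eq, mul_one, longest_mul_self hw]
    exact hR.one_mem_gaussJordan

theorem mul_mem_GJ (ε : Sgn) {r s : R} (hr : r ∈ GJ cs Λ ε) (hs : s ∈ GJ cs Λ ε) :
    r * s ∈ GJ cs Λ ε := by
  cases ε with
  | pos =>
    rw [hR.GJ_pos] at *
    exact hR.gaussJordan_mul hr hs
  | neg =>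
    rw [hR.GJ_neg hw, Set.mem_ofPred_eq] at *
    rw [longest_conj_mul hw]
    exact hR.gaussJordan_mul hr hs

/-- `GJ^ε` as a submonoid. -/
def submonoidGJ (ε : Sgn) : Submonoid R where
  carrier := GJ cs Λ ε
  one_mem' := hR.one_mem_GJ hw ε
  mul_mem' := hR.mul_mem_GJ hw ε

/-- `JG^ε` as a submonoid. -/
def submonoidJG (ε : Sgn) : Submonoid R where
  carrier := JG cs Λ ε
  one_mem' := by
    have h : starInv (1 : R) = 1 := by simpa using hR.factorizable.starInv_unit 1
    rw [hR.mem_JG_iff hw, h]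
    exact hR.one_mem_GJ hw _
  mul_mem' := by
    intro r s hr hs
    rw [hR.mem_JG_iff hw] at *
    rw [hR.factorizable.starInv_mul]
    exact hR.mul_mem_GJ hw _ hs hr

omit hw [Finite Rˣ] in
/-- The submonoid `O`. -/
def submonoidOh : Submonoid R where
  carrier := orderPreserving cs Λ
  one_mem' := gaussJordan_subset hR.one_mem_gaussJordan
  mul_mem' := hR.orderPreserving_mul

/-- For `ε = +` split `x e y = (x e)(e y)`; for `ε = -` split the `w₀`-conjugate and conjugate back.
-/
theorem exists_eq_mul_of_mem (ε : Sgn) {r : R} (hr : r ∈ orderPreserving cs Λ) :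
    ∃ a ∈ JG cs Λ ε.opp, ∃ b ∈ GJ cs Λ ε, r = a * b := by
  have hF := hR.factorizable
  have key : ∀ r ∈ orderPreserving cs Λ, ∃ a b, starInv a ∈ gaussJordan cs Λ ∧
      b ∈ gaussJordan cs Λ ∧ r = a * b := by
    rintro r ⟨e, he, x, y, hx, hy, rfl⟩
    refine ⟨x * e, e * y, ⟨e, he, x⁻¹, isLeftMin_inv.2 hx, ?_⟩, ⟨e, he, y, hy, rfl⟩, ?_⟩
    · simpa using hF.starInv_form (hR.idem e he) x 1
    · rw [← mul_assoc, mul_assoc (x : R) e e, hR.mul_self he]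
  cases ε with
  | pos =>
    obtain ⟨a, b, ha, hb, h⟩ := key r hr
    rw [Sgn.opp, hR.JG_neg, hR.GJ_pos]
    exact ⟨a, ha, b, hb, h⟩
  | neg =>
    obtain ⟨a, b, ha, hb, h⟩ := key _ (hR.longest_conj_mem_orderPreserving hw hr)
    rw [Sgn.opp, hR.JG_pos hw, hR.GJ_neg hw]
    refine ⟨w₀ * a * w₀, ?_, w₀ * b * w₀, ?_, ?_⟩
    · rwa [Set.mem_ofPred_eq, longest_conj_conj hw]
    · rwa [Set.mem_ofPred_eq, longest_conj_conj hw]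
    · rw [← longest_conj_mul hw, ← h, longest_conj_conj hw]

theorem isSmallestMonoid_orderPreserving {A : Set R} (hA : A ⊆ orderPreserving cs Λ) (ε : Sgn)
    (h : GJ cs Λ ε ∪ JG cs Λ ε.opp ⊆ A) : IsSmallestMonoid A (orderPreserving cs Λ) := by
  refine ⟨⟨⟨hR.submonoidOh, rfl⟩, hA⟩, ?_⟩
  rintro _ ⟨⟨N, rfl⟩, hN⟩ r hr
  obtain ⟨a, ha, b, hb, rfl⟩ := hR.exists_eq_mul_of_mem hw ε hr
  exact N.mul_mem (hN (h (Or.inr ha))) (hN (h (Or.inl hb)))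

omit hw [Finite Rˣ] in
theorem isInverseMonoid_submonoidOh : IsInverseMonoid hR.submonoidOh := by
  have hF := hR.factorizable
  rintro ⟨m, hm⟩
  refine ⟨⟨starInv m, hR.starInv_mem_orderPreserving hm⟩, ?_, ?_⟩
  · have := hF.isInverseOf_starInv m
    exact ⟨Subtype.ext this.1, Subtype.ext this.2⟩
  · rintro ⟨n, hn⟩ ⟨h1, h2⟩
    exact Subtype.ext (hF.starInv_eq ⟨congrArg Subtype.val h1, congrArg Subtype.val h2⟩).symm

-- An inverse taken inside `N` is an inverse in `R`, where inverses are unique.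
omit hw [Finite Rˣ] in
theorem starInv_mem_of_isInverseMonoid {N : Submonoid R} (hN : IsInverseMonoid N) {r : R}
    (hr : r ∈ N) : starInv r ∈ N := by
  obtain ⟨⟨n, hn⟩, ⟨h1, h2⟩, -⟩ := hN ⟨r, hr⟩
  rwa [hR.factorizable.starInv_eq ⟨congrArg Subtype.val h1, congrArg Subtype.val h2⟩]

theorem isSmallestInverseMonoid_GJ (ε : Sgn) :
    IsSmallestInverseMonoid (GJ cs Λ ε) (orderPreserving cs Λ) := by
  refine ⟨⟨⟨hR.submonoidOh, rfl, hR.isInverseMonoid_submonoidOh⟩, hR.GJ_subset hw ε⟩, ?_⟩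
  rintro _ ⟨⟨N, rfl, hN⟩, hA⟩ r hr
  obtain ⟨a, ha, b, hb, rfl⟩ := hR.exists_eq_mul_of_mem hw ε hr
  refine N.mul_mem ?_ (hA hb)
  rw [hR.mem_JG_iff hw, opp_opp] at ha
  rw [← hR.factorizable.starInv_starInv a]
  exact hR.starInv_mem_of_isInverseMonoid hN (hA ha)

theorem isSmallestInverseMonoid_JG (ε : Sgn) :
    IsSmallestInverseMonoid (JG cs Λ ε) (orderPreserving cs Λ) := by
  refine ⟨⟨⟨hR.submonoidOh, rfl, hR.isInverseMonoid_submonoidOh⟩, hR.JG_subset hw ε⟩, ?_⟩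
  rintro _ ⟨⟨N, rfl, hN⟩, hA⟩ r hr
  obtain ⟨a, ha, b, hb, rfl⟩ := hR.exists_eq_mul_of_mem hw ε.opp hr
  rw [opp_opp] at ha
  refine N.mul_mem (hA ha) ?_
  rw [hR.mem_GJ_iff hw, opp_opp] at hb
  rw [← hR.factorizable.starInv_starInv b]
  exact hR.starInv_mem_of_isInverseMonoid hN (hA hb)

/-! ### Maximum elements for both signs -/

omit [Finite Rˣ] in
theorem starInv_mem_rightTranslate_iff {A : Set R} {r : R} :
    starInv r ∈ rightTranslate A w₀ ↔ r ∈ leftTranslate w₀ {s | starInv s ∈ A} := by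
  have hF := hR.factorizable
  constructor
  · rintro ⟨a, ha, h⟩
    refine ⟨starInv a, by rwa [Set.mem_ofPred_eq, hF.starInv_starInv], ?_⟩
    simp only at h ⊢
    rw [← hF.starInv_starInv r, ← h, hF.starInv_mul, hF.starInv_unit, hw.inv_eq]
  · rintro ⟨a, ha, rfl⟩
    exact ⟨starInv a, ha, by rw [hF.starInv_mul, hF.starInv_unit, hw.inv_eq]⟩

omit [Finite Rˣ] in
theorem starInv_mem_leftTranslate_iff {A : Set R} {r : R} :
    starInv r ∈ leftTranslate w₀ A ↔ r ∈ rightTranslate {s | starInv s ∈ A} w₀ := by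
  have hF := hR.factorizable
  constructor
  · rintro ⟨a, ha, h⟩
    refine ⟨starInv a, by rwa [Set.mem_ofPred_eq, hF.starInv_starInv], ?_⟩
    simp only at h ⊢
    rw [← hF.starInv_starInv r, ← h, hF.starInv_mul, hF.starInv_unit, hw.inv_eq]
  · rintro ⟨a, ha, rfl⟩
    exact ⟨starInv a, ha, by rw [hF.starInv_mul, hF.starInv_unit, hw.inv_eq]⟩

theorem leftTranslate_GJ (ε : Sgn) :
    leftTranslate w₀ (GJ cs Λ ε) = maxSet cs Λ ε (greenL R) := by
  have hF := hR.factorizable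
  cases ε with
  | pos => rw [hR.maxSet_greenL hw, hR.GJ_pos]
  | neg =>
    rw [hR.maxSet_neg fun r t => hF.greenL_iff_greenR_starInv, hR.maxSet_greenR hw, GJ,
      hR.minSet_neg fun r t => hF.greenL_iff_greenR_starInv, hR.minSet_greenR hw]
    ext r
    exact (hR.starInv_mem_rightTranslate_iff hw).symm

theorem rightTranslate_JG (ε : Sgn) :
    rightTranslate (JG cs Λ ε) w₀ = maxSet cs Λ ε (greenR R) := by
  have hF := hR.factorizable
  cases ε with
  | pos => rw [hR.maxSet_greenR hw, JG, hR.minSet_greenR hw]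
  | neg =>
    rw [hR.maxSet_neg fun r t => hF.greenR_iff_greenL_starInv, hR.maxSet_greenL hw, JG,
      hR.minSet_neg fun r t => hF.greenR_iff_greenL_starInv, hR.minSet_greenL]
    ext r
    exact (hR.starInv_mem_leftTranslate_iff hw).symm

/-- Elements of `Λ` are their own inverses, so inversion carries `w₀ Λ` to `Λ w₀`. -/
theorem maxSet_neg_greenJ : maxSet cs Λ .neg (greenJ R) = rightTranslate Λ w₀ := by
  have hF := hR.factorizable
  have hΛ : ∀ e ∈ Λ, starInv e = e := fun e he => by
    simpa using hF.starInv_form (hR.idem e he) 1 1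
  rw [hR.maxSet_neg fun r t => hR.greenJ_iff_starInv, hR.maxSet_greenJ hw]
  ext r
  refine (hR.starInv_mem_leftTranslate_iff hw).trans ?_
  have : {s | starInv s ∈ Λ} = Λ := by
    ext s
    constructor
    · intro h
      rw [← hF.starInv_starInv s, hΛ _ h]
      exact h
    · intro h
      rw [Set.mem_ofPred_eq, hΛ s h]
      exact h
  rw [this]

theorem leftTranslate_orderPreserving :
    leftTranslate w₀ (orderPreserving cs Λ) = rightTranslate (orderPreserving cs Λ) w₀ := by
  ext r
  constructor
  · rintro ⟨a, ha, rfl⟩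
    refine ⟨_, hR.longest_conj_mem_orderPreserving hw ha, ?_⟩
    simp [mul_assoc, longest_mul_self hw]
  · rintro ⟨a, ha, rfl⟩
    refine ⟨_, hR.longest_conj_mem_orderPreserving hw ha, ?_⟩
    simp [mul_assoc, longest_mul_cancel hw]

theorem rightTranslate_orderPreserving (ε : Sgn) :
    rightTranslate (orderPreserving cs Λ) w₀ = maxSet cs Λ ε (greenH R) := by
  have hF := hR.factorizable
  cases ε with
  | pos => rw [hR.maxSet_greenH hw]
  | neg =>
    rw [hR.maxSet_neg fun r t => hF.greenH_iff_starInv, hR.maxSet_greenH hw,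
      ← hR.leftTranslate_orderPreserving hw]
    ext r
    refine Iff.trans ?_ (hR.starInv_mem_leftTranslate_iff hw).symm
    have : {s | starInv s ∈ orderPreserving cs Λ} = orderPreserving cs Λ := by
      ext s
      refine ⟨fun h => ?_, hR.starInv_mem_orderPreserving⟩
      rw [← hF.starInv_starInv s]
      exact hR.starInv_mem_orderPreserving h
    rw [this, hR.leftTranslate_orderPreserving hw]

omit hR [Finite Rˣ] in
theorem leftTranslate_eq_oppLattice (A : Set R) :
    leftTranslate w₀ A = rightTranslate (oppLattice w₀ A) w₀ := by
  rw [leftTranslate, rightTranslate, oppLattice, Set.image_image]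
  congr 1
  ext r
  simp [mul_assoc, longest_mul_self hw]

omit hR [Finite Rˣ] in
theorem leftTranslate_oppLattice (A : Set R) :
    leftTranslate w₀ (oppLattice w₀ A) = rightTranslate A w₀ := by
  rw [leftTranslate, rightTranslate, oppLattice, Set.image_image]
  congr 1
  ext r
  simp [mul_assoc, longest_mul_cancel hw]

/-! ### Existence of minimum elements -/

theorem exists_GJ (ε : Sgn) (r : R) : ∃ c ∈ minSet cs Λ ε (greenL R), greenL R r c := by
  cases ε with
  | pos => rw [hR.minSet_greenL]; exact hR.exists_gaussJordan r
  | neg =>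
    refine hR.exists_minSet_neg (fun r t => hR.factorizable.greenL_iff_greenR_starInv) ?_ r
    rw [hR.minSet_greenR hw]
    exact hR.exists_jordanGauss

theorem exists_JG (ε : Sgn) (r : R) : ∃ c ∈ minSet cs Λ ε (greenR R), greenR R r c := by
  cases ε with
  | pos => rw [hR.minSet_greenR hw]; exact hR.exists_jordanGauss r
  | neg =>
    refine hR.exists_minSet_neg (fun r t => hR.factorizable.greenR_iff_greenL_starInv) ?_ r
    rw [hR.minSet_greenL]
    exact hR.exists_gaussJordan

theorem exists_NU (ε : Sgn) (r : R) : ∃ c ∈ minSet cs Λ ε (greenJ R), greenJ R r c := by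
  have hpos : ∀ r, ∃ c ∈ minSet cs Λ .pos (greenJ R), greenJ R r c := by
    rw [hR.minSet_greenJ hw]
    exact hR.exists_inter hw
  cases ε with
  | pos => exact hpos r
  | neg => exact hR.exists_minSet_neg (fun r t => hR.greenJ_iff_starInv) hpos r

omit hw [Finite Rˣ] in
theorem exists_Oh (ε : Sgn) (r : R) : ∃ c ∈ minSet cs Λ ε (greenH R), greenH R r c := by
  have hpos : ∀ r, ∃ c ∈ minSet cs Λ .pos (greenH R), greenH R r c := by
    rw [hR.minSet_greenH]
    exact hR.exists_orderPreserving
  cases ε with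
  | pos => exact hpos r
  | neg => exact hR.exists_minSet_neg (fun r t => hR.factorizable.greenH_iff_starInv) hpos r

end

end IsRennerCoxeterSystem

end RennerCoxeter

/-! ### Assembly of the twelve assertions -/

open RennerCoxeter in
theorem mainTheorem7 {R : Type*} [Monoid R] [Finite Rˣ] {B : Type*} {M : CoxeterMatrix B}
    (cs : CoxeterSystem M Rˣ) (Λ : Set R) (hR : IsRennerCoxeterSystem cs Λ) :
    ∃ w₀ : Rˣ, IsLongest cs w₀ ∧
    -- (1)
    Oh cs Λ .pos = Oh cs Λ .neg ∧
    -- (2)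
    (∀ ε, NU cs Λ ε = GJ cs Λ ε ∩ JG cs Λ ε) ∧
    -- (3)
    (∀ ε, (∃ N : Submonoid R, (N : Set R) = GJ cs Λ ε) ∧
      (∃ N : Submonoid R, (N : Set R) = JG cs Λ ε) ∧
      (∃ N : Submonoid R, (N : Set R) = NU cs Λ ε) ∧
      (∃ N : Submonoid R, (N : Set R) = Oh cs Λ ε)) ∧
    -- (4)
    (GJ cs Λ .pos = starSet (JG cs Λ .neg) ∧ JG cs Λ .pos = starSet (GJ cs Λ .neg)) ∧
    -- (5)
    ((∀ ε, IsSmallestMonoid (GJ cs Λ ε ∪ JG cs Λ ε.opp) (Oh cs Λ .pos)) ∧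
      IsSmallestMonoid (⋃ ε, GJ cs Λ ε ∪ JG cs Λ ε) (Oh cs Λ .pos)) ∧
    -- (6)
    (∀ ε, IsSmallestInverseMonoid (GJ cs Λ ε) (Oh cs Λ .pos)) ∧
    -- (7)
    (∀ ε, IsSmallestInverseMonoid (JG cs Λ ε) (Oh cs Λ .pos)) ∧
    -- (8)
    (∀ ε, leftTranslate w₀ (GJ cs Λ ε) = maxSet cs Λ ε (greenL R)) ∧
    -- (9)
    (∀ ε, rightTranslate (JG cs Λ ε) w₀ = maxSet cs Λ ε (greenR R)) ∧
    -- (10)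
    (leftTranslate w₀ Λ = rightTranslate (oppLattice w₀ Λ) w₀ ∧
      rightTranslate (oppLattice w₀ Λ) w₀ = maxSet cs Λ .pos (greenJ R) ∧
      leftTranslate w₀ (oppLattice w₀ Λ) = rightTranslate Λ w₀ ∧
      rightTranslate Λ w₀ = maxSet cs Λ .neg (greenJ R)) ∧
    -- (11)
    (leftTranslate w₀ (Oh cs Λ .pos) = rightTranslate (Oh cs Λ .pos) w₀ ∧
      ∀ ε, rightTranslate (Oh cs Λ .pos) w₀ = maxSet cs Λ ε (greenH R)) ∧
    -- (12)
    (∀ ε, Set.BijOn (fun r => (Quotient.mk (greenJ R) r)) (NU cs Λ ε) Set.univ ∧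
      Set.BijOn (fun r => (Quotient.mk (greenL R) r)) (GJ cs Λ ε) Set.univ ∧
      Set.BijOn (fun r => (Quotient.mk (greenR R) r)) (JG cs Λ ε) Set.univ ∧
      Set.BijOn (fun r => (Quotient.mk (greenH R) r)) (Oh cs Λ ε) Set.univ) := by
  obtain ⟨w₀, hw⟩ := exists_isLongestIn cs Set.univ
  have hF := hR.factorizable
  refine ⟨w₀, hw.isLongest, ?_⟩
  -- Both signs give the same explicit set, which settles (1) and makes the other assertions about
  -- `O` independent of the sign.
  simp only [hR.Oh_eq]
  refine ⟨trivial, hR.NU_eq hw, fun ε => ⟨⟨hR.submonoidGJ hw ε, rfl⟩, ⟨hR.submonoidJG hw ε, rfl⟩,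
    ⟨hR.submonoidGJ hw ε ⊓ hR.submonoidJG hw ε, (hR.NU_eq hw ε).symm⟩, ⟨hR.submonoidOh, rfl⟩⟩,
    ⟨?_, ?_⟩, ⟨fun ε => ?_, ?_⟩, hR.isSmallestInverseMonoid_GJ hw,
    hR.isSmallestInverseMonoid_JG hw, hR.leftTranslate_GJ hw, hR.rightTranslate_JG hw,
    ⟨IsRennerCoxeterSystem.leftTranslate_eq_oppLattice hw Λ, ?_,
      IsRennerCoxeterSystem.leftTranslate_oppLattice hw Λ, (hR.maxSet_neg_greenJ hw).symm⟩,
    ⟨hR.leftTranslate_orderPreserving hw, hR.rightTranslate_orderPreserving hw⟩,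
    fun ε => ⟨hR.bijOn_minSet (hR.exists_NU hw ε), hR.bijOn_minSet (hR.exists_GJ hw ε),
      hR.bijOn_minSet (hR.exists_JG hw ε), ?_⟩⟩
  · rw [hF.starSet_eq]
    ext r
    exact hR.mem_GJ_iff hw .pos
  · rw [hF.starSet_eq]
    ext r
    exact hR.mem_JG_iff hw .pos
  · exact hR.isSmallestMonoid_orderPreserving hw
      (Set.union_subset (hR.GJ_subset hw ε) (hR.JG_subset hw _)) ε subset_rfl
  · refine hR.isSmallestMonoid_orderPreserving hw
      (Set.iUnion_subset fun ε => Set.union_subset (hR.GJ_subset hw ε) (hR.JG_subset hw ε)) .pos ?_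
    rintro r (hr | hr)
    · exact Set.mem_iUnion.2 ⟨.pos, Or.inl hr⟩
    · exact Set.mem_iUnion.2 ⟨.neg, Or.inr hr⟩
  · rw [← IsRennerCoxeterSystem.leftTranslate_eq_oppLattice hw Λ, hR.maxSet_greenJ hw]
  · rw [← hR.Oh_eq ε]
    exact hR.bijOn_minSet (hR.exists_Oh ε)
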